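/- **Theorem 1.2.** For $0<p<1$, a $p$-random subset $A\subseteq\mathbb{Z}_{\ge 0}^d$ is a random subset containing each point of $\mathbb{Z}_{\ge 0}^d$ independently with probability $p$; write $\langle A\rangle:=\{a_1+\cdots+a_k : k\in\mathbb{Z}_{\ge 0},\ a_1,\ldots,a_k\in A\}$ (repetitions allowed, the empty sum $0$ included), and for real $Z$ let $$\mathcal{R}_d(p,Z):=\{(x_1,\ldots,x_d)\in\mathbb{Z}_{\ge 0}^d : (x_1+\log p^{-1})\cdots(x_d+\log p^{-1})\le Z\}.$$ For each positive integer $d$ there are constants $C,c_1,c_2>0$ depending only on $d$, and a function $\varepsilon=\varepsilon_d$ with $\varepsilon(p)\to 0$ as $p\to 0^+$, such that the following holds. Let $A\subseteq\mathbb{Z}_{\ge 0}^d$ be a $p$-random subset and $S:=\langle A\rangle$. Then with probability tending to $1$ as $p\to 0^+$, all of the following hold: $$\left|S\cap\mathcal{R}_d\left(p,C^{-1}p^{-1}(\log p^{-1})^{d+1}\right)\right|\le \varepsilon(p)\left|\mathcal{R}_d\left(p,C^{-1}p^{-1}(\log p^{-1})^{d+1}\right)\right|,$$ $$\mathbb{Z}_{\ge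 0}^d\setminus\mathcal{R}_d\left(p,Cp^{-1}(\log p^{-1})^{d+1}\right)\subseteq S,$$ and in particular the gap set $\mathbb{Z}_{\ge 0}^d\setminus S$ is finite with $$c_1\,p^{-1}(\log p^{-1})^{2d}\le\left|\mathbb{Z}_{\ge 0}^d\setminus S\right|\le c_2\,p^{-1}(\log p^{-1})^{2d}.$$ -/

import Mathlib

open Filter Topology unitInterval ProbabilityTheory

noncomputable section

/-- The set `R_d(p, Z)` of lattice points `x` in `ℤ_{≥0}^d` under the shifted hyperboloid
`(x₁ + log p⁻¹) ⋯ (x_d + log p⁻¹) = Z`. -/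
def hyperboloidRegion (d : ℕ) (p Z : ℝ) : Set (Fin d → ℕ) :=
  {x | ∏ i, ((x i : ℝ) + Real.log p⁻¹) ≤ Z}

/-- The threshold scale `p⁻¹ (log p⁻¹)^(d+1)`. -/
def thresholdScale (d : ℕ) (p : ℝ) : ℝ :=
  p⁻¹ * Real.log p⁻¹ ^ (d + 1)

/-- The semigroup `⟨A⟩ = {a₁ + ⋯ + a_k : k ≥ 0, a₁, …, a_k ∈ A}`, repetitions allowed and the
empty sum `0` included. -/
def generatedSemigroup {d : ℕ} (A : Set (Fin d → ℕ)) : Set (Fin d → ℕ) :=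
  (AddSubmonoid.closure A : Set (Fin d → ℕ))

/-- The event `E p A` about a `p`-random subset `A` of `ℤ_{≥0}^d` (each lattice point belongs to
`A` independently with probability `p`) holds with high probability: its probability tends to `1`
as the density `p ∈ [0, 1]` tends to `0` through positive values. -/
def WithHighProbability (d : ℕ) (E : I → Set (Fin d → ℕ) → Prop) : Prop :=
  Tendsto (fun p : I ↦ setBernoulli (Set.univ : Set (Fin d → ℕ)) p {A | E p A})
    (𝓝[>] (0 : I)) (𝓝 1)

end

/-! Write L = log p⁻¹. Probabilities are computed in finite windows, where an expectation is the
finite sum `bernoulliMean`; `setBernoulli_le_bernoulliMean` transfers the bounds to the random set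
without any measurability.

Covering. Fix x beyond the hyperboloid and let i be the direction of its largest coordinate. Take a
box with sides about x_l / L, and x_i / L² in direction i. If D is a set of at most 1/p points of
this box, adding the random points of a fresh translate of a doubled box yields a set of sums that
fills at least 2|D| points of a translate of the box, with probability bounded below
(`le_bernoulliMean_doubling`). This needs p times the box volume to be at least 8. The box has at
least a constant times ∏ (x_l + L) / L^(d+1) points, which is where the threshold comes from. Order
L disjoint translates stacked in direction i give order L successes: the first ones take |D| from 1
to about 1/p, and each later one contributes about 1/p new generated points e ≤ x. Then x is missed
only if every x - e is missed, which has probability at most a large power of p. Halving points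
(`mem_of_forall_dyadic_shell`) reduces the covering claim to polynomially many x in 1/p, and a union
bound finishes.

Sparsity. For weights 0 < u_l < 1, the sum of u^y over generated y is at most ∏ (1 - u^a)⁻¹ over the
generators a. Averaging this product directly loses a logarithm: already for d = 1, ∑ u^a / (1 -
u^a) has order (1 - u)⁻¹ log (1 - u)⁻¹. After a square root the relevant sum is ∑ u^a / √(1 - u^a),
of order (1 - u)⁻¹ (`sum_range_pow_div_sqrt_le`). Hence the square root of the number of generated
points in each dyadic box below the threshold has mean at most p^(-1/4), while the region has about
p⁻¹ L^(2d) points.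

The gap count follows by comparing with the sizes of the two regions, which are estimated by
harmonic sums. -/

/-! ### Expectations over random subsets of a finite window -/

section BernoulliMean

open Finset MeasureTheory

variable {α : Type*} [DecidableEq α]

/-- The expectation of `f B` for a `p`-random subset `B` of the finite set `W`. -/
noncomputable def bernoulliMean (p : ℝ) (W : Finset α) (f : Finset α → ℝ) : ℝ :=
  ∑ B ∈ W.powerset, p ^ #B * (1 - p) ^ #(W \ B) * f B

theorem bernoulliMean_empty (p : ℝ) (f : Finset α → ℝ) : bernoulliMean p ∅ f = f ∅ := by
  simp [bernoulliMean]

theorem bernoulliMean_insert (p : ℝ) {W : Finset α} {a : α} (ha : a ∉ W) (f : Finset α → ℝ) :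
    bernoulliMean p (insert a W) f =
      (1 - p) * bernoulliMean p W f + p * bernoulliMean p W (fun B ↦ f (insert a B)) := by
  unfold bernoulliMean
  rw [Finset.sum_powerset_insert ha, Finset.mul_sum, Finset.mul_sum]
  congr 1 <;> refine Finset.sum_congr rfl fun B hB ↦ ?_
  · have haB : a ∉ B := fun h ↦ ha (Finset.mem_powerset.1 hB h)
    rw [Finset.insert_sdiff_of_notMem _ haB, Finset.card_insert_of_notMem (by simp [ha])]
    ring
  · have haB : a ∉ B := fun h ↦ ha (Finset.mem_powerset.1 hB h)
    rw [Finset.card_insert_of_notMem haB, Finset.insert_sdiff_insert,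
      Finset.sdiff_insert_of_notMem ha]
    ring

theorem bernoulliMean_add (p : ℝ) (W : Finset α) (f g : Finset α → ℝ) :
    bernoulliMean p W (fun B ↦ f B + g B) = bernoulliMean p W f + bernoulliMean p W g := by
  simp [bernoulliMean, mul_add, Finset.sum_add_distrib]

theorem bernoulliMean_const_mul (p : ℝ) (W : Finset α) (c : ℝ) (f : Finset α → ℝ) :
    bernoulliMean p W (fun B ↦ c * f B) = c * bernoulliMean p W f := by
  simp only [bernoulliMean, Finset.mul_sum]
  exact Finset.sum_congr rfl fun B _ ↦ by ring

theorem bernoulliMean_sum {ι : Type*} (p : ℝ) (W : Finset α) (s : Finset ι)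
    (f : ι → Finset α → ℝ) :
    bernoulliMean p W (fun B ↦ ∑ i ∈ s, f i B) = ∑ i ∈ s, bernoulliMean p W (f i) := by
  simp only [bernoulliMean, Finset.mul_sum]
  rw [Finset.sum_comm]

theorem bernoulliMean_prod (p : ℝ) (W : Finset α) (g : α → ℝ) :
    bernoulliMean p W (fun B ↦ ∏ a ∈ B, g a) = ∏ a ∈ W, (1 - p + p * g a) := by
  simp_rw [add_comm (1 - p)]
  rw [Finset.prod_add]
  refine Finset.sum_congr rfl fun B _ ↦ ?_
  rw [Finset.prod_mul_distrib, Finset.prod_const, Finset.prod_const]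
  ring

theorem bernoulliMean_const (p : ℝ) (W : Finset α) (c : ℝ) :
    bernoulliMean p W (fun _ ↦ c) = c := by
  have h := bernoulliMean_prod p W (fun _ ↦ 1)
  have h' := bernoulliMean_const_mul p W c (fun _ ↦ 1)
  simp only [Finset.prod_const_one, mul_one, sub_add_cancel] at h h'
  rw [h', h, mul_one]

theorem bernoulliMean_sub (p : ℝ) (W : Finset α) (f g : Finset α → ℝ) :
    bernoulliMean p W (fun B ↦ f B - g B) = bernoulliMean p W f - bernoulliMean p W g := by
  simp [bernoulliMean, mul_sub, Finset.sum_sub_distrib]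

theorem bernoulliMean_mono {p : ℝ} (h0 : 0 ≤ p) (h1 : p ≤ 1) {W : Finset α}
    {f g : Finset α → ℝ} (h : ∀ B ⊆ W, f B ≤ g B) :
    bernoulliMean p W f ≤ bernoulliMean p W g := by
  have : 0 ≤ 1 - p := by linarith
  exact Finset.sum_le_sum fun B hB ↦
    mul_le_mul_of_nonneg_left (h B (Finset.mem_powerset.1 hB)) (by positivity)

theorem bernoulliMean_union (p : ℝ) {W V : Finset α} (h : Disjoint W V) (f : Finset α → ℝ) :
    bernoulliMean p (W ∪ V) f =
      bernoulliMean p W (fun B ↦ bernoulliMean p V (fun B' ↦ f (B ∪ B'))) := by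
  induction W using Finset.induction_on generalizing f with
  | empty => simp [bernoulliMean_empty]
  | insert a W ha ih =>
    rw [Finset.disjoint_insert_left] at h
    rw [Finset.insert_union, bernoulliMean_insert p (by simp [ha, h.1]), ih h.2, ih h.2,
      bernoulliMean_insert p ha]
    simp [Finset.insert_union]

/-- The probability that a `p`-random subset of `W` misses `V ⊆ W`. -/
theorem bernoulliMean_indicator_disjoint (p : ℝ) {W V : Finset α} (h : V ⊆ W) :
    bernoulliMean p W ({B | Disjoint B V}.indicator 1) = (1 - p) ^ #V := by
  have := bernoulliMean_prod p W (fun a ↦ if a ∈ V then 0 else 1)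
  convert this using 1
  · congr 1
    ext B
    by_cases hB : Disjoint B V
    · rw [Set.indicator_of_mem (by exact hB), Finset.prod_eq_one]
      · rfl
      · intro a ha
        simp [Finset.disjoint_left.1 hB ha]
    · rw [Set.indicator_of_notMem (by exact hB)]
      obtain ⟨a, ha, ha'⟩ := Finset.not_disjoint_iff.1 hB
      exact (Finset.prod_eq_zero ha (by simp [ha'])).symm
  · have (a : α) : (1 - p + p * if a ∈ V then 0 else 1) = if a ∈ V then 1 - p else 1 := by
      split_ifs <;> ring
    simp_rw [this]
    rw [Finset.prod_ite, Finset.prod_const, Finset.prod_const_one, mul_one,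
      Finset.filter_mem_eq_inter, Finset.inter_eq_right.2 h]

theorem bernoulliMean_card (p : ℝ) (W : Finset α) :
    bernoulliMean p W (fun B ↦ (#B : ℝ)) = p * #W := by
  induction W using Finset.induction_on with
  | empty => simp [bernoulliMean_empty]
  | insert a W ha ih =>
    have : bernoulliMean p W (fun B ↦ (#(insert a B) : ℝ)) =
        bernoulliMean p W (fun B ↦ (#B : ℝ) + 1) :=
      Finset.sum_congr rfl fun B hB ↦ by
        beta_reduce
        rw [Finset.card_insert_of_notMem fun h ↦ ha (Finset.mem_powerset.1 hB h)]
        push_cast; rfl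
    rw [bernoulliMean_insert p ha, this, bernoulliMean_add, bernoulliMean_const, ih,
      Finset.card_insert_of_notMem ha]
    push_cast; ring

theorem bernoulliMean_card_sq (p : ℝ) (W : Finset α) :
    bernoulliMean p W (fun B ↦ (#B : ℝ) ^ 2) = (p * #W) ^ 2 + p * (1 - p) * #W := by
  induction W using Finset.induction_on with
  | empty => simp [bernoulliMean_empty]
  | insert a W ha ih =>
    have : bernoulliMean p W (fun B ↦ (#(insert a B) : ℝ) ^ 2) =
        bernoulliMean p W (fun B ↦ (#B : ℝ) ^ 2 + (2 * (#B : ℝ) + 1)) :=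
      Finset.sum_congr rfl fun B hB ↦ by
        beta_reduce
        rw [Finset.card_insert_of_notMem fun h ↦ ha (Finset.mem_powerset.1 hB h)]
        push_cast; ring
    rw [bernoulliMean_insert p ha, this, bernoulliMean_add, bernoulliMean_add,
      bernoulliMean_const_mul, bernoulliMean_card, bernoulliMean_const, ih,
      Finset.card_insert_of_notMem ha]
    push_cast; ring

theorem setBernoulli_trace_eq (p : I) (W B : Finset α) (hB : B ⊆ W) :
    setBernoulli (Set.univ : Set α) p {A | ∀ a ∈ W, a ∈ A ↔ a ∈ B} =
      ENNReal.ofReal ((p : ℝ) ^ #B * (1 - (p : ℝ)) ^ #(W \ B)) := by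
  have hp : ENNReal.ofReal (p : ℝ) = (toNNReal p : ENNReal) := by
    rw [ENNReal.ofReal]; congr 1; ext; simp [p.2.1]
  have hq : ENNReal.ofReal (1 - (p : ℝ)) = (toNNReal (σ p) : ENNReal) := by
    rw [ENNReal.ofReal]; congr 1; ext; simp [p.2.2]
  rw [setBernoulli_apply']
  have hset : (fun q : α → Prop ↦ {i | q i}) ⁻¹' {A | ∀ a ∈ W, a ∈ A ↔ a ∈ B} =
      Set.pi (W : Set α) (fun a ↦ {q : Prop | q ↔ a ∈ B}) := by
    ext q; simp [Set.mem_pi]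
  rw [hset, Measure.infinitePi_pi _ (fun _ _ ↦ MeasurableSet.of_discrete),
    ENNReal.ofReal_mul (by have := p.2.1; positivity), ENNReal.ofReal_pow p.2.1,
    ENNReal.ofReal_pow (sub_nonneg.2 p.2.2), hp, hq, mul_comm,
    ← Finset.prod_sdiff hB, ← Finset.prod_const, ← Finset.prod_const]
  congr 1
  · refine Finset.prod_congr rfl fun a ha ↦ ?_
    simp [(Finset.mem_sdiff.1 ha).2]
  · refine Finset.prod_congr rfl fun a ha ↦ ?_
    simp [ha]

/-- An event which forces the trace of the random set on a finite set `W` to lie in `E` is at most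
as likely as `E` is for a `p`-random subset of `W`. -/
theorem setBernoulli_le_bernoulliMean (p : I) (W : Finset α) (F : Set (Set α))
    (E : Set (Finset α)) (h : ∀ A ∈ F, ∀ B ⊆ W, (∀ a ∈ W, a ∈ A ↔ a ∈ B) → B ∈ E) :
    setBernoulli (Set.univ : Set α) p F ≤
      ENNReal.ofReal (bernoulliMean p W (E.indicator 1)) := by
  classical
  have hp0 : (0 : ℝ) ≤ p := p.2.1
  have hp1 : (0 : ℝ) ≤ 1 - p := sub_nonneg.2 p.2.2
  -- A finite cover by cylinders: subadditivity of the outer measure suffices, so `F` need not be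
  -- measurable.
  have hsub : F ⊆ ⋃ B ∈ W.powerset.filter (· ∈ E), {A : Set α | ∀ a ∈ W, a ∈ A ↔ a ∈ B} := by
    intro A hA
    have hB : ∀ a ∈ W, a ∈ A ↔ a ∈ W.filter (· ∈ A) := fun a ha ↦ by simp [ha]
    simp only [Set.mem_iUnion]
    exact ⟨W.filter (· ∈ A), by simpa using h A hA _ (Finset.filter_subset _ _) hB, hB⟩
  refine (measure_mono hsub).trans ((measure_biUnion_finset_le _ _).trans ?_)
  rw [bernoulliMean, ENNReal.ofReal_sum_of_nonneg]
  · rw [Finset.sum_filter]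
    refine Finset.sum_le_sum fun B hB ↦ ?_
    split_ifs with hE
    · rw [setBernoulli_trace_eq p W B (Finset.mem_powerset.1 hB), Set.indicator_of_mem hE]
      simp
    · simp
  · intro B _
    have : (0 : ℝ) ≤ E.indicator 1 B := Set.indicator_nonneg (fun _ _ ↦ zero_le_one) _
    positivity

end BernoulliMean

/-! ### One doubling step -/

section Growth

open Finset

variable {ι : Type*} [Fintype ι] [DecidableEq ι]

/-- The points `w` of the box `[0, q]` such that `v + w` is a sum of an element of `D` and an
element of `B`. -/
def shiftedSums (q v : ι → ℕ) (D B : Finset (ι → ℕ)) : Finset (ι → ℕ) :=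
  (Icc 0 q).filter (fun w ↦ ∃ z ∈ D, v + w - z ∈ B)

theorem card_shiftedSums_le {q v : ι → ℕ} (hqv : q ≤ v) {D : Finset (ι → ℕ)}
    (hD : D ⊆ Icc 0 q) (B : Finset (ι → ℕ)) : #(shiftedSums q v D B) ≤ #D * #B := by
  refine le_trans (Finset.card_le_card ?_)
    (Finset.card_image₂_le (fun z a : ι → ℕ ↦ a + z - v) D B)
  intro w hw
  obtain ⟨-, z, hz, hB⟩ := Finset.mem_filter.1 hw
  refine Finset.mem_image₂.2 ⟨z, hz, _, hB, ?_⟩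
  have hzv : z ≤ v := (Finset.mem_Icc.1 (hD hz)).2.trans hqv
  ext l
  have : z l ≤ v l := hzv l
  simp only [Pi.sub_apply, Pi.add_apply]
  omega

theorem card_Icc_sub_add_le {q v : ι → ℕ} (hqv : q ≤ v) :
    #(Icc (v - q) (v + q)) ≤ 2 ^ Fintype.card ι * #(Icc 0 q) := by
  rw [Pi.card_Icc, Pi.card_Icc, ← Finset.card_univ, ← Finset.prod_const,
    ← Finset.prod_mul_distrib]
  refine Finset.prod_le_prod' fun l _ ↦ ?_
  have : q l ≤ v l := hqv l
  simp only [Nat.card_Icc, Pi.sub_apply, Pi.add_apply, Pi.zero_apply]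
  omega

theorem one_sub_pow_le_one_sub_half {p : ℝ} (h0 : 0 ≤ p) (h1 : p ≤ 1) {s : ℕ} (hs : p * s ≤ 1) :
    (1 - p) ^ s ≤ 1 - p * s / 2 := by
  have h2 : (1 - p) ^ s ≤ Real.exp (-(p * s)) := by
    have : 1 - p ≤ Real.exp (-p) := by linarith [Real.add_one_le_exp (-p)]
    calc (1 - p) ^ s ≤ Real.exp (-p) ^ s := pow_le_pow_left₀ (by linarith) this s
      _ = Real.exp (-(p * s)) := by rw [← Real.exp_nat_mul]; ring_nf
  have h3 : 0 ≤ p * s := by positivity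
  have h4 : Real.exp (-(p * s)) * (1 + p * s) ≤ 1 := by
    rw [Real.exp_neg, inv_mul_le_iff₀ (Real.exp_pos _)]
    linarith [Real.add_one_le_exp (p * s)]
  have h5 : Real.exp (-(p * s)) ≤ 1 / (1 + p * s) := by
    rw [le_div_iff₀ (by positivity)]; exact h4
  refine h2.trans (h5.trans ?_)
  rw [div_le_iff₀ (by positivity)]
  nlinarith

/-- For each w in the box, the points v + w - z with z ∈ D are distinct and lie in the window around
v, so all are missed with probability (1 - p)^|D| ≤ 1 - p|D|/2. The condition `q ≤ v` keeps the
truncated subtraction exact. -/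
theorem le_bernoulliMean_card_shiftedSums {p : ℝ} (h0 : 0 ≤ p) (h1 : p ≤ 1) {q v : ι → ℕ}
    (hqv : q ≤ v) {D : Finset (ι → ℕ)} (hD : D ⊆ Icc 0 q) (hs : p * #D ≤ 1) :
    p * #D * #(Icc 0 q) / 2 ≤
      bernoulliMean p (Icc (v - q) (v + q)) (fun B ↦ (#(shiftedSums q v D B) : ℝ)) := by
  have key (B : Finset (ι → ℕ)) : (#(shiftedSums q v D B) : ℝ) = ∑ w ∈ Icc 0 q,
      (1 - ({B | Disjoint B (D.image fun z ↦ v + w - z)} : Set (Finset (ι → ℕ))).indicator 1 B) := by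
    rw [shiftedSums, Finset.card_filter]
    push_cast
    refine Finset.sum_congr rfl fun w _ ↦ ?_
    by_cases h : ∃ z ∈ D, v + w - z ∈ B
    · rw [if_pos h, Set.indicator_of_notMem, sub_zero]
      obtain ⟨z, hz, hB⟩ := h
      exact fun hd ↦ Finset.disjoint_left.1 hd hB (Finset.mem_image_of_mem _ hz)
    · rw [if_neg h, Set.indicator_of_mem, Pi.one_apply, sub_self]
      push Not at h
      refine Finset.disjoint_right.2 fun a ha ↦ ?_
      obtain ⟨z, hz, rfl⟩ := Finset.mem_image.1 ha
      exact h z hz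
  simp_rw [key]
  rw [bernoulliMean_sum]
  have hw (w : ι → ℕ) (hw : w ∈ Icc 0 q) : p * #D / 2 ≤ bernoulliMean p (Icc (v - q) (v + q))
      (fun B ↦ 1 - ({B | Disjoint B (D.image fun z ↦ v + w - z)} :
        Set (Finset (ι → ℕ))).indicator 1 B) := by
    have hw' := (Finset.mem_Icc.1 hw).2
    have hsub : (D.image fun z ↦ v + w - z) ⊆ Icc (v - q) (v + q) := by
      intro a ha
      obtain ⟨z, hz, rfl⟩ := Finset.mem_image.1 ha
      have hz' := (Finset.mem_Icc.1 (hD hz)).2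
      refine Finset.mem_Icc.2 ⟨fun l ↦ ?_, fun l ↦ ?_⟩ <;>
      · have : w l ≤ q l := hw' l; have : z l ≤ q l := hz' l; have : q l ≤ v l := hqv l
        simp only [Pi.sub_apply, Pi.add_apply]
        omega
    have hcard : #(D.image fun z ↦ v + w - z) = #D := by
      refine Finset.card_image_of_injOn fun z hz z' hz' h ↦ ?_
      have hz := (Finset.mem_Icc.1 (hD hz)).2
      have hz' := (Finset.mem_Icc.1 (hD hz')).2
      ext l
      have := congrFun h l; have : z l ≤ q l := hz l; have : z' l ≤ q l := hz' l
      have : q l ≤ v l := hqv l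
      simp only [Pi.sub_apply, Pi.add_apply] at *
      omega
    rw [bernoulliMean_sub, bernoulliMean_const]
    have := bernoulliMean_indicator_disjoint p hsub
    rw [hcard] at this
    have h' := one_sub_pow_le_one_sub_half h0 h1 hs
    linarith
  calc p * #D * #(Icc 0 q) / 2 = ∑ w ∈ Icc 0 q, p * #D / 2 := by
        rw [Finset.sum_const, nsmul_eq_mul]; ring
    _ ≤ _ := Finset.sum_le_sum hw

/-- A second-moment argument for X = |`shiftedSums`|. Its mean is at least s m / 2, and `hq` makes
this at least twice the target 2s. Since X ≤ s|B|, the second moment of |B| replaces that of X, and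
no covariances are needed. -/
theorem le_bernoulliMean_doubling {p : ℝ} (h0 : 0 < p) (h1 : p ≤ 1) {q v : ι → ℕ}
    (hqv : q ≤ v) {D : Finset (ι → ℕ)} (hD : D ⊆ Icc 0 q) (hne : D.Nonempty) (hs : p * #D ≤ 1)
    (hq : 8 ≤ p * #(Icc 0 q)) :
    1 / (32 * 4 ^ Fintype.card ι) ≤ bernoulliMean p (Icc (v - q) (v + q))
      ({B | 2 * #D ≤ #(shiftedSums q v D B)}.indicator 1) := by
  set s : ℝ := (#D : ℝ) with hs_def
  set m : ℝ := p * #(Icc 0 q) with hm_def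
  set K : ℝ := 4 ^ Fintype.card ι with hK_def
  have hK : 1 ≤ K := one_le_pow₀ (by norm_num)
  have hs0 : 0 < s := by rw [hs_def]; exact_mod_cast hne.card_pos
  -- With t = `lam` * s * m, the final lower bound is t - 8Kt². It is maximal at t = 1/(16K), with
  -- value 1/(32K).
  set lam : ℝ := 1 / (16 * K * s * m) with hlam
  have hlam0 : 0 < lam := by positivity
  have hmean := le_bernoulliMean_card_shiftedSums h0.le h1 hqv hD hs
  have hW : p * #(Icc (v - q) (v + q)) ≤ 2 ^ Fintype.card ι * m := by
    have : (#(Icc (v - q) (v + q)) : ℝ) ≤ 2 ^ Fintype.card ι * #(Icc 0 q) := by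
      exact_mod_cast card_Icc_sub_add_le hqv
    calc p * #(Icc (v - q) (v + q)) ≤ p * (2 ^ Fintype.card ι * #(Icc 0 q)) := by gcongr
      _ = _ := by ring
  have hsq : bernoulliMean p (Icc (v - q) (v + q)) (fun B ↦ (s * #B : ℝ) ^ 2) ≤
      s ^ 2 * (2 * K * m ^ 2) := by
    simp_rw [mul_pow]
    rw [bernoulliMean_const_mul, bernoulliMean_card_sq]
    have h2K : (2 : ℝ) ^ Fintype.card ι * 2 ^ Fintype.card ι = K := by
      rw [← mul_pow]; norm_num [hK_def]
    have h2 : (1 : ℝ) ≤ 2 ^ Fintype.card ι := one_le_pow₀ (by norm_num)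
    set y : ℝ := p * #(Icc (v - q) (v + q))
    have hy : 0 ≤ y := by positivity
    have e1 : y ^ 2 ≤ K * m ^ 2 := by
      calc y ^ 2 ≤ (2 ^ Fintype.card ι * m) ^ 2 := by gcongr
        _ = K * m ^ 2 := by rw [← h2K]; ring
    have e2 : p * (1 - p) * #(Icc (v - q) (v + q)) ≤ y := by
      have : p * (1 - p) * #(Icc (v - q) (v + q)) = y * (1 - p) := by ring
      rw [this]; nlinarith
    have e3 : y ≤ K * m ^ 2 := by
      refine hW.trans ?_
      rw [← h2K]
      have : m ≤ m ^ 2 := by nlinarith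
      have h3 : (2 : ℝ) ^ Fintype.card ι * 1 ≤ 2 ^ Fintype.card ι * 2 ^ Fintype.card ι := by gcongr
      calc (2 : ℝ) ^ Fintype.card ι * m = (2 ^ Fintype.card ι * 1) * m := by ring
        _ ≤ (2 ^ Fintype.card ι * 2 ^ Fintype.card ι) * m ^ 2 := by gcongr
    have : 0 ≤ s ^ 2 := by positivity
    nlinarith
  -- A quadratic minorant of the indicator: 4y - 4y² ≤ 1 for y = `lam` * X covers success, and X ≤
  -- 2s makes the left side nonpositive on failure.
  have hpt (B : Finset (ι → ℕ)) : 4 * lam * #(shiftedSums q v D B) - 8 * lam * s -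
      4 * lam ^ 2 * (s * #B) ^ 2 ≤
      ({B | 2 * #D ≤ #(shiftedSums q v D B)} : Set (Finset (ι → ℕ))).indicator 1 B := by
    have hX : (#(shiftedSums q v D B) : ℝ) ≤ s * #B := by
      rw [hs_def]; exact_mod_cast card_shiftedSums_le hqv hD B
    have hX2 : (#(shiftedSums q v D B) : ℝ) ^ 2 ≤ (s * #B) ^ 2 := by gcongr
    have hX3 := mul_le_mul_of_nonneg_left hX2 (by positivity : (0 : ℝ) ≤ 4 * lam ^ 2)
    by_cases hB : 2 * #D ≤ #(shiftedSums q v D B)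
    · rw [Set.indicator_of_mem (by exact hB), Pi.one_apply]
      nlinarith [sq_nonneg (2 * lam * #(shiftedSums q v D B) - 1), mul_pos hlam0 hs0]
    · rw [Set.indicator_of_notMem (by exact hB)]
      have : (#(shiftedSums q v D B) : ℝ) ≤ 2 * s := by
        rw [hs_def]; exact_mod_cast (not_le.1 hB).le
      nlinarith [mul_le_mul_of_nonneg_left this hlam0.le, sq_nonneg (lam * (s * #B))]
  have hmain := bernoulliMean_mono h0.le h1 (W := Icc (v - q) (v + q)) (fun B _ ↦ hpt B)
  rw [bernoulliMean_sub, bernoulliMean_sub, bernoulliMean_const_mul, bernoulliMean_const_mul,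
    bernoulliMean_const, bernoulliMean_const_mul] at hmain
  refine le_trans ?_ hmain
  have hm0 : 0 < m := by linarith
  have a1 : 4 * lam * (s * m / 2) ≤ 4 * lam * bernoulliMean p (Icc (v - q) (v + q))
      (fun B ↦ (#(shiftedSums q v D B) : ℝ)) := by
    gcongr
    refine le_trans (le_of_eq ?_) hmean
    rw [hm_def]; ring
  have a2 := mul_le_mul_of_nonneg_left hsq (by positivity : (0 : ℝ) ≤ 4 * lam ^ 2)
  have a3 : 8 * lam * s ≤ lam * (s * m) := by nlinarith [mul_pos hlam0 hs0]
  have a4 : lam * (s * m) = 1 / (16 * K) := by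
    rw [hlam]; field_simp
  have a5 : 4 * lam ^ 2 * (s ^ 2 * (2 * K * m ^ 2)) = 1 / (32 * K) := by
    have : 4 * lam ^ 2 * (s ^ 2 * (2 * K * m ^ 2)) = 8 * K * (lam * (s * m)) ^ 2 := by ring
    rw [this, a4]; field_simp; norm_num
  have a6 : 1 / (16 * K) = 1 / (32 * K) + 1 / (32 * K) := by field_simp; norm_num
  linarith

end Growth

/-! ### Iterated growth through disjoint windows -/

section Chain

open Finset

variable {ι : Type*} [Fintype ι] [DecidableEq ι]

/-- The finite set `B` together with the translate `c + D` of `D` generates at least `m` points,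
all of them at most `u` and with `i`-th coordinate beyond that of `c + q`. -/
def GeneratesMany (i : ι) (q : ι → ℕ) (m : ℕ) (c u : ι → ℕ) (D B : Finset (ι → ℕ)) : Prop :=
  ∃ E : Finset (ι → ℕ), m ≤ #E ∧ ∀ e ∈ E, e ≤ u ∧ c i + q i < e i ∧
    e ∈ AddSubmonoid.closure ((B : Set (ι → ℕ)) ∪ (D.image (c + ·) : Finset (ι → ℕ)))

theorem GeneratesMany.mono {i : ι} {q : ι → ℕ} {m : ℕ} {c u u' : ι → ℕ}
    {D B B' : Finset (ι → ℕ)} (h : GeneratesMany i q m c u D B) (hB : B ⊆ B') (hu : u ≤ u') :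
    GeneratesMany i q m c u' D B' := by
  obtain ⟨E, hE, h⟩ := h
  refine ⟨E, hE, fun e he ↦ ⟨(h e he).1.trans hu, (h e he).2.1, ?_⟩⟩
  refine AddSubmonoid.closure_mono ?_ (h e he).2.2
  exact Set.union_subset_union_left _ (by exact_mod_cast hB)

theorem add_mem_closure_of_mem_shiftedSums {q v c : ι → ℕ} (hqv : q ≤ v)
    {D B : Finset (ι → ℕ)} (hD : D ⊆ Icc 0 q) {w : ι → ℕ} (hw : w ∈ shiftedSums q v D B) :
    c + v + w ∈ AddSubmonoid.closure
      ((B : Set (ι → ℕ)) ∪ (D.image (c + ·) : Finset (ι → ℕ))) := by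
  obtain ⟨-, z, hz, hB⟩ := Finset.mem_filter.1 hw
  have : c + v + w = (c + z) + (v + w - z) := by
    ext l
    have h1 : z l ≤ q l := (Finset.mem_Icc.1 (hD hz)).2 l
    have h2 : q l ≤ v l := hqv l
    simp only [Pi.add_apply, Pi.sub_apply]
    omega
  rw [this]
  refine add_mem (AddSubmonoid.subset_closure (Or.inr ?_)) (AddSubmonoid.subset_closure (Or.inl hB))
  exact_mod_cast Finset.mem_image_of_mem (c + ·) hz

/-- One successful growth step: passing from `c + D` to the translate `c + v + D'`. -/
theorem GeneratesMany.of_step {i : ι} {q : ι → ℕ} {m m' : ℕ} {c u v : ι → ℕ}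
    {D D' B B' : Finset (ι → ℕ)} (hqv : q ≤ v) (hqi : q i < v i) (hD : D ⊆ Icc 0 q)
    (hD' : D' ⊆ shiftedSums q v D B) (h : GeneratesMany i q m (c + v) u D' B')
    (hm : m' ≤ m + #D') (hu : c + v + q ≤ u) : GeneratesMany i q m' c u D (B ∪ B') := by
  obtain ⟨E, hE, h⟩ := h
  have hgen : ∀ w ∈ D', c + v + w ∈ AddSubmonoid.closure
      (((B ∪ B' : Finset (ι → ℕ)) : Set (ι → ℕ)) ∪ (D.image (c + ·) : Finset (ι → ℕ))) := by
    intro w hw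
    refine AddSubmonoid.closure_mono ?_ (add_mem_closure_of_mem_shiftedSums hqv hD (hD' hw))
    exact Set.union_subset_union_left _ (by push_cast; exact Set.subset_union_left)
  have hle : ∀ w ∈ D', w ≤ q := fun w hw ↦
    (Finset.mem_Icc.1 (Finset.mem_filter.1 (hD' hw)).1).2
  refine ⟨E ∪ D'.image (c + v + ·), ?_, fun e he ↦ ?_⟩
  · rw [Finset.card_union_of_disjoint, Finset.card_image_of_injective _ (add_right_injective _)]
    · omega
    · refine Finset.disjoint_right.2 fun e he he' ↦ ?_
      obtain ⟨w, hw, rfl⟩ := Finset.mem_image.1 he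
      have h1 := (h _ he').2.1
      have h2 : w i ≤ q i := hle w hw i
      simp only [Pi.add_apply] at h1
      omega
  · rcases Finset.mem_union.1 he with he | he
    · obtain ⟨h1, h2, h3⟩ := h e he
      refine ⟨h1, ?_, ?_⟩
      · simp only [Pi.add_apply] at h2
        omega
      · refine AddSubmonoid.closure_le.2 ?_ h3
        rintro a (ha | ha)
        · refine AddSubmonoid.subset_closure (Or.inl ?_)
          push_cast; exact Or.inr ha
        · obtain ⟨w, hw, rfl⟩ := Finset.mem_image.1 (Finset.mem_coe.1 ha)
          exact hgen w hw
    · obtain ⟨w, hw, rfl⟩ := Finset.mem_image.1 he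
      refine ⟨(add_le_add_right (hle w hw) _).trans hu, ?_, hgen w hw⟩
      simp only [Pi.add_apply]
      omega

theorem indicator_one_le_indicator_one {α β : Type*} {s : Set α} {t : Set β} {a : α} {b : β}
    (h : a ∈ s → b ∈ t) : s.indicator (1 : α → ℝ) a ≤ t.indicator (1 : β → ℝ) b := by
  classical
  by_cases ha : a ∈ s
  · simp [ha, h ha]
  · rw [Set.indicator_of_notMem ha]
    exact Set.indicator_nonneg (fun _ _ ↦ zero_le_one) b

/-- A Chernoff bound by induction on the rounds. Here n counts the successes still asked for, of
which the truncated difference k₁ - k are spent on reaching size s. Each round succeeds with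
probability at least η, halving the potential 2^n, so the potential shrinks on average by the factor
1 - η/2. -/
theorem bernoulliMean_not_generatesMany_le {p : ℝ} (h0 : 0 < p) (h1 : p ≤ 1) {i : ι}
    {q : ι → ℕ} {v : ℕ → ι → ℕ} (hqv : ∀ j, q ≤ v j) (hqi : ∀ j, q i < v j i)
    (hW : Pairwise fun j j' ↦ Disjoint (Icc (v j - q) (v j + q)) (Icc (v j' - q) (v j' + q)))
    (hq : 8 ≤ p * #(Icc 0 q)) {s : ℕ} (hs0 : 0 < s) (hs : p * s ≤ 1) (k₁ : ℕ) (hk₁ : s ≤ 2 ^ k₁)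
    (r j n k : ℕ) (c : ι → ℕ) (D : Finset (ι → ℕ)) (hD : D ⊆ Icc 0 q)
    (hcard : #D = min (2 ^ k) s) :
    bernoulliMean p ((Finset.Ico j (j + r)).biUnion fun t ↦ Icc (v t - q) (v t + q))
      ({B | ¬ GeneratesMany i q (s * (n - (k₁ - k))) c (c + ∑ t ∈ Finset.Ico j (j + r), v t + q)
        D B}.indicator 1) ≤ 2 ^ n * (1 - 1 / (64 * 4 ^ Fintype.card ι)) ^ r := by
  set η : ℝ := 1 / (32 * 4 ^ Fintype.card ι) with hη
  have hη' : (1 : ℝ) / (64 * 4 ^ Fintype.card ι) = η / 2 := by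
    rw [hη]; field_simp; norm_num
  rw [hη']
  have hη0 : 0 < η := by positivity
  have hη1 : η ≤ 1 := by
    rw [hη, div_le_one (by positivity)]
    have : (1 : ℝ) ≤ 4 ^ Fintype.card ι := one_le_pow₀ (by norm_num)
    linarith
  have hle1 (W : Finset (ι → ℕ)) (F : Set (Finset (ι → ℕ))) :
      bernoulliMean p W (F.indicator 1) ≤ 1 := by
    refine (bernoulliMean_mono h0.le h1 (g := fun _ ↦ 1) fun B _ ↦ ?_).trans
      (bernoulliMean_const p W 1).le
    exact Set.indicator_le_self' (f := 1) (by simp) B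
  induction r generalizing j n k c D with
  | zero => simpa using (hle1 _ _).trans (one_le_pow₀ (by norm_num : (1 : ℝ) ≤ 2))
  | succ r ih =>
    rcases n with - | n
    -- With no successes left to ask for, the required number of points is 0 and the empty set is a
    -- witness.
    · have hempty : {B : Finset (ι → ℕ) | ¬ GeneratesMany i q (s * (0 - (k₁ - k))) c
          (c + ∑ t ∈ Finset.Ico j (j + (r + 1)), v t + q) D B} = ∅ := by
        refine Set.eq_empty_of_forall_notMem fun B hB ↦ hB ⟨∅, by simp, by simp⟩
      rw [hempty, Set.indicator_empty]
      exact (bernoulliMean_const p _ 0).le.trans (mul_nonneg (by positivity)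
        (pow_nonneg (by linarith) _))
    have hIco : Finset.Ico j (j + (r + 1)) = insert j (Finset.Ico (j + 1) (j + 1 + r)) := by
      ext t
      simp only [Finset.mem_Ico, Finset.mem_insert]
      omega
    have hj : j ∉ Finset.Ico (j + 1) (j + 1 + r) := by simp
    rw [hIco, Finset.biUnion_insert, Finset.sum_insert hj, bernoulliMean_union]
    swap
    · rw [Finset.disjoint_biUnion_right]
      intro t ht
      exact hW (by rintro rfl; exact hj ht)
    set V := (Finset.Ico (j + 1) (j + 1 + r)).biUnion fun t ↦ Icc (v t - q) (v t + q)
    set u := c + (v j + ∑ t ∈ Finset.Ico (j + 1) (j + 1 + r), v t) + q with hu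
    set F : ℕ → ℝ := fun n ↦ 2 ^ n * (1 - η / 2) ^ r with hF
    have hDpos : D.Nonempty := by
      rw [← Finset.card_pos, hcard]; positivity
    have hpD : p * #D ≤ 1 := by
      refine le_trans ?_ hs
      have : #D ≤ s := by omega
      gcongr
    have hstep := le_bernoulliMean_doubling h0 h1 (hqv j) hD hDpos hpD hq
    have hpt (B : Finset (ι → ℕ)) : bernoulliMean p V (fun B' ↦
        ({B | ¬ GeneratesMany i q (s * (n + 1 - (k₁ - k))) c u D B} :
          Set (Finset (ι → ℕ))).indicator (1 : Finset (ι → ℕ) → ℝ) (B ∪ B')) ≤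
        F (n + 1) - F n *
          ({B | 2 * #D ≤ #(shiftedSums q (v j) D B)} : Set (Finset (ι → ℕ))).indicator 1 B := by
      by_cases hB : 2 * #D ≤ #(shiftedSums q (v j) D B)
      · rw [Set.indicator_of_mem (by exact hB)]
        -- The new set is trimmed to at most s points, so that p|D'| ≤ 1 persists in the next round.
        obtain ⟨D', hD', hcard'⟩ := Finset.exists_subset_card_eq
          (show min (2 ^ (k + 1)) s ≤ #(shiftedSums q (v j) D B) by
            rw [pow_succ]; omega)
        refine le_trans (bernoulliMean_mono h0.le h1 fun B' _ ↦ indicator_one_le_indicator_one ?_)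
          ((ih (j + 1) n (k + 1) (c + v j) D' (hD'.trans (Finset.filter_subset _ _))
            hcard').trans ?_)
        · refine mt fun h ↦ ?_
          have hu' : c + v j + ∑ t ∈ Finset.Ico (j + 1) (j + 1 + r), v t + q = u := by
            rw [hu, add_assoc c]
          rw [hu'] at h
          refine h.of_step (hqv j) (hqi j) hD hD' ?_ ?_
          · rw [hcard']
            rcases le_or_gt k₁ k with hk | hk
            · have : s ≤ 2 ^ (k + 1) := hk₁.trans (Nat.pow_le_pow_right (by norm_num) (by omega))
              rw [min_eq_right this, show n + 1 - (k₁ - k) = n + 1 by omega,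
                show n - (k₁ - (k + 1)) = n by omega, mul_add, mul_one]
            · rw [show n + 1 - (k₁ - k) = n - (k₁ - (k + 1)) by omega]
              exact Nat.le_add_right _ _
          · rw [← hu']
            exact add_le_add_left (le_add_of_nonneg_right zero_le) _
        · simp only [hF, Pi.one_apply]
          apply le_of_eq; ring
      · rw [Set.indicator_of_notMem (by exact hB), mul_zero, sub_zero]
        refine le_trans (bernoulliMean_mono h0.le h1 fun B' _ ↦ indicator_one_le_indicator_one ?_)
          (ih (j + 1) (n + 1) k c D hD hcard)
        refine mt fun h ↦ h.mono Finset.subset_union_right ?_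
        rw [hu]
        gcongr
        exact le_add_of_nonneg_left zero_le
    refine (bernoulliMean_mono h0.le h1 fun B _ ↦ hpt B).trans ?_
    rw [bernoulliMean_sub, bernoulliMean_const, bernoulliMean_const_mul]
    have := mul_le_mul_of_nonneg_left hstep
      (mul_nonneg (by positivity) (pow_nonneg (by linarith) _) : 0 ≤ F n)
    have hfin : F (n + 1) - F n * η = 2 ^ (n + 1) * (1 - η / 2) ^ (r + 1) := by
      simp only [hF]; ring
    linarith

end Chain

/-! ### Probability that a given point is not generated -/

section Hitting

open Finset

variable {ι : Type*} [Fintype ι] [DecidableEq ι]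

/-- Either the chain in the windows fails, or it yields s(n - k₁) generated points e ≤ x. In the
latter case x is generated as soon as some x - e lies in the random set. -/
theorem setBernoulli_notMem_closure_le (p : I) (h0 : 0 < (p : ℝ)) {i : ι}
    {q : ι → ℕ} {v : ℕ → ι → ℕ} (hqv : ∀ j, q ≤ v j) (hqi : ∀ j, q i < v j i)
    (hW : Pairwise fun j j' ↦ Disjoint (Icc (v j - q) (v j + q)) (Icc (v j' - q) (v j' + q)))
    (hq : 8 ≤ (p : ℝ) * #(Icc 0 q)) {s : ℕ} (hs0 : 0 < s) (hs : (p : ℝ) * s ≤ 1) (k₁ : ℕ)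
    (hk₁ : s ≤ 2 ^ k₁) (r n : ℕ) {x : ι → ℕ} (hx : ∑ t ∈ Finset.Ico 0 r, v t + q ≤ x)
    (hxi : ∀ t < r, v t i + q i + (∑ t ∈ Finset.Ico 0 r, v t i + q i) < x i) :
    setBernoulli (Set.univ : Set (ι → ℕ)) p
      {A | x ∉ AddSubmonoid.closure A} ≤ ENNReal.ofReal
        (2 ^ n * (1 - 1 / (64 * 4 ^ Fintype.card ι)) ^ r + (1 - (p : ℝ)) ^ (s * (n - k₁))) := by
  have h1 : (p : ℝ) ≤ 1 := p.2.2
  set W := (Finset.Ico 0 (0 + r)).biUnion fun t ↦ Icc (v t - q) (v t + q) with hWdef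
  -- The points x - e lie beyond every window in direction i by `hxi`, so the final trial is
  -- independent of the chain.
  set V := (Icc 0 x).filter fun a ↦ ∀ t < r, v t i + q i < a i with hVdef
  have hWV : Disjoint W V := by
    refine Finset.disjoint_left.2 fun a haW haV ↦ ?_
    obtain ⟨t, ht, hat⟩ := Finset.mem_biUnion.1 haW
    have h2 := (Finset.mem_filter.1 haV).2 t (by simpa using ht)
    have h3 : a i ≤ v t i + q i := (Finset.mem_Icc.1 hat).2 i
    omega
  refine (setBernoulli_le_bernoulliMean p (W ∪ V) _
    {B | x ∉ AddSubmonoid.closure (B : Set (ι → ℕ))} fun A hA B hB hAB hxB ↦ ?_).trans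
    (ENNReal.ofReal_le_ofReal ?_)
  · refine hA (AddSubmonoid.closure_mono ?_ hxB)
    exact fun a ha ↦ (hAB a (hB ha)).2 ha
  rw [bernoulliMean_union _ hWV]
  -- The chain starts from D = {0}, of size 2^0, which adds nothing to the generated semigroup.
  have hchain := bernoulliMean_not_generatesMany_le h0 h1 hqv hqi hW hq hs0 hs k₁ hk₁ r 0 n 0 0
    {0} (by simp) (by simp; omega)
  rw [← hWdef] at hchain
  set G : Set (Finset (ι → ℕ)) := {B | ¬ GeneratesMany i q (s * (n - (k₁ - 0))) 0
    (0 + ∑ t ∈ Finset.Ico 0 (0 + r), v t + q) {0} B} with hG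
  have hpt (B : Finset (ι → ℕ)) : bernoulliMean p V (fun B' ↦
      ({B | x ∉ AddSubmonoid.closure (B : Set (ι → ℕ))} : Set (Finset (ι → ℕ))).indicator
        (1 : Finset (ι → ℕ) → ℝ) (B ∪ B')) ≤ G.indicator 1 B + (1 - (p : ℝ)) ^ (s * (n - k₁)) := by
    by_cases hB : B ∈ G
    · rw [Set.indicator_of_mem hB, Pi.one_apply]
      refine (bernoulliMean_mono h0.le h1 (g := fun _ ↦ 1) fun B' _ ↦ ?_).trans
        ((bernoulliMean_const _ V 1).le.trans ?_)
      · exact Set.indicator_le_self' (f := 1) (by simp) _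
      · linarith [pow_nonneg (sub_nonneg.2 h1) (s * (n - k₁))]
    · rw [Set.indicator_of_notMem hB, zero_add]
      obtain ⟨E, hE, hprop⟩ := not_not.1 hB
      have hEx : ∀ e ∈ E, e ≤ x := fun e he ↦ (hprop e he).1.trans (by simpa using hx)
      have hEV : E.image (x - ·) ⊆ V := by
        intro a ha
        obtain ⟨e, he, rfl⟩ := Finset.mem_image.1 ha
        refine Finset.mem_filter.2 ⟨Finset.mem_Icc.2 ⟨zero_le, tsub_le_self⟩, fun t ht ↦ ?_⟩
        have h2 := hxi t ht
        have h3 : e i ≤ (0 + ∑ t ∈ Finset.Ico 0 (0 + r), v t + q) i := (hprop e he).1 i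
        simp only [zero_add, Pi.add_apply, Finset.sum_apply] at h3
        simp only [Pi.sub_apply]
        omega
      have hcard : #(E.image (x - ·)) = #E := by
        refine Finset.card_image_of_injOn fun e he e' he' h ↦ ?_
        ext l
        have h2 := congrFun h l
        have h3 : e l ≤ x l := hEx e he l
        have h4 : e' l ≤ x l := hEx e' he' l
        simp only [Pi.sub_apply] at h2
        omega
      refine (bernoulliMean_mono h0.le h1 (g := {B | Disjoint B (E.image (x - ·))}.indicator 1)
        fun B' _ ↦ indicator_one_le_indicator_one fun hxB ↦ ?_).trans ?_
      · refine Finset.disjoint_right.2 fun a ha haB' ↦ hxB ?_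
        obtain ⟨e, he, rfl⟩ := Finset.mem_image.1 ha
        have h2 : e + (x - e) = x := add_tsub_cancel_of_le (hEx e he)
        rw [← h2]
        refine add_mem ?_ (AddSubmonoid.subset_closure (by push_cast; exact Or.inr haB'))
        refine AddSubmonoid.closure_le.2 ?_ (hprop e he).2.2
        rintro b (hb | hb)
        · exact AddSubmonoid.subset_closure (by push_cast; exact Or.inl hb)
        · have : b = 0 := by simpa using hb
          rw [this]; exact zero_mem _
      · rw [bernoulliMean_indicator_disjoint _ hEV, hcard]
        exact pow_le_pow_of_le_one (sub_nonneg.2 h1) (by linarith) (by simpa using hE)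
  refine (bernoulliMean_mono h0.le h1 fun B _ ↦ hpt B).trans ?_
  rw [bernoulliMean_add, bernoulliMean_const]
  gcongr

/-- Half-lengths of the boxes used to reach `x` in `r` rounds: the `i`-th side is shorter, so that
there is room for `r` disjoint translates. -/
def stepBox (i : ι) (r : ℕ) (x : ι → ℕ) (l : ι) : ℕ :=
  if l = i then x l / (4 * (r + 1) ^ 2) else x l / (r + 1)

/-- The centre of the `t`-th translate of the box `stepBox i r x`. -/
def stepCenter (i : ι) (r : ℕ) (x : ι → ℕ) (t : ℕ) (l : ι) : ℕ :=
  if l = i then stepBox i r x l + 1 + (2 * stepBox i r x l + 1) * t else stepBox i r x l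

/-- The windows are disjoint because they are stacked in direction i. Their centres there grow
linearly in t and sum to at most (2Q + 1) r², whence the quadratic denominator in `stepBox`; in the
other directions the centres are constant and a linear one suffices. -/
theorem setBernoulli_notMem_closure_le_of_stepBox (p : I) (h0 : 0 < (p : ℝ)) (i : ι) (r n : ℕ)
    {x : ι → ℕ} (hxr : 2 * (r + 1) ^ 2 ≤ x i) (hq : 8 ≤ (p : ℝ) * #(Icc 0 (stepBox i r x)))
    {s : ℕ} (hs0 : 0 < s) (hs : (p : ℝ) * s ≤ 1) (k₁ : ℕ) (hk₁ : s ≤ 2 ^ k₁) :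
    setBernoulli (Set.univ : Set (ι → ℕ)) p
      {A | x ∉ AddSubmonoid.closure A} ≤ ENNReal.ofReal
        (2 ^ n * (1 - 1 / (64 * 4 ^ Fintype.card ι)) ^ r + (1 - (p : ℝ)) ^ (s * (n - k₁))) := by
  set Q := stepBox i r x i with hQ
  have hvi (t : ℕ) : stepCenter i r x t i = Q + 1 + (2 * Q + 1) * t := by simp [stepCenter, hQ]
  have hvl (t : ℕ) {l : ι} (hl : l ≠ i) : stepCenter i r x t l = stepBox i r x l := by
    simp [stepCenter, hl]
  have hQx : (2 * Q + 1) * (r + 1) ^ 2 ≤ x i := by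
    have h2 : 4 * (r + 1) ^ 2 * Q ≤ x i := by
      rw [hQ, stepBox, if_pos rfl]; exact Nat.mul_div_le _ _
    nlinarith
  have hle (t : ℕ) (ht : t < r) : stepCenter i r x t i + Q ≤ (2 * Q + 1) * r := by
    rw [hvi]
    have : (2 * Q + 1) * (t + 1) ≤ (2 * Q + 1) * r := Nat.mul_le_mul_left _ ht
    nlinarith
  have hsum : ∑ t ∈ Finset.Ico 0 r, stepCenter i r x t i ≤ (2 * Q + 1) * r ^ 2 := by
    calc ∑ t ∈ Finset.Ico 0 r, stepCenter i r x t i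
        ≤ ∑ t ∈ Finset.Ico 0 r, (2 * Q + 1) * r := by
          refine Finset.sum_le_sum fun t ht ↦ ?_
          have := hle t (Finset.mem_Ico.1 ht).2
          omega
      _ = (2 * Q + 1) * r ^ 2 := by
          rw [Finset.sum_const, Nat.card_Ico, smul_eq_mul]; simp only [tsub_zero]; ring
  refine setBernoulli_notMem_closure_le p h0 (i := i) (v := stepCenter i r x) (fun t l ↦ ?_)
    (fun t ↦ ?_) (fun t t' htt' ↦ ?_) hq hs0 hs k₁ hk₁ r n (fun l ↦ ?_) fun t ht ↦ ?_
  · by_cases hl : l = i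
    · rw [hl, hvi, ← hQ]
      exact (Nat.le_succ Q).trans (Nat.le_add_right _ _)
    · rw [hvl t hl]
  · rw [hvi, ← hQ]; nlinarith
  · refine Finset.disjoint_left.2 fun a ha ha' ↦ htt' ?_
    have h2 : stepCenter i r x t i - Q ≤ a i := (Finset.mem_Icc.1 ha).1 i
    have h3 : a i ≤ stepCenter i r x t i + Q := (Finset.mem_Icc.1 ha).2 i
    have h4 : stepCenter i r x t' i - Q ≤ a i := (Finset.mem_Icc.1 ha').1 i
    have h5 : a i ≤ stepCenter i r x t' i + Q := (Finset.mem_Icc.1 ha').2 i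
    rw [hvi] at h2 h3 h4 h5
    have e1 : (2 * Q + 1) * t < (2 * Q + 1) * (t' + 1) := by rw [mul_add]; omega
    have e2 : (2 * Q + 1) * t' < (2 * Q + 1) * (t + 1) := by rw [mul_add]; omega
    have f1 := lt_of_mul_lt_mul_left e1 (Nat.zero_le _)
    have f2 := lt_of_mul_lt_mul_left e2 (Nat.zero_le _)
    omega
  · rw [Pi.add_apply, Finset.sum_apply]
    by_cases hl : l = i
    · rw [hl, ← hQ]
      have : (2 * Q + 1) * (r + 1) ^ 2 =
          ((2 * Q + 1) * r ^ 2 + Q) + (2 * ((2 * Q + 1) * r) + Q + 1) := by ring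
      rw [this] at hQx
      exact (Nat.add_le_add_right hsum Q).trans ((Nat.le_add_right _ _).trans hQx)
    · simp only [hvl _ hl]
      rw [Finset.sum_const, Nat.card_Ico, smul_eq_mul, stepBox, if_neg hl]
      have := Nat.mul_div_le (x l) (r + 1)
      simp only [tsub_zero]
      linarith
  · have := hle t ht
    rw [← hQ]
    nlinarith

/-- Rounding up absorbs the shift by L: even a side of length 0 contributes one lattice point, worth
r + 1 ≥ L. One factor r + 1 is lost per direction and one more in direction i, which gives the
exponent d + 1. -/
theorem prod_add_le_mul_card_stepBox (i : ι) (r : ℕ) (x : ι → ℕ) {L : ℝ} (hL0 : 0 ≤ L)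
    (hL : L ≤ r + 1) (hLx : L ≤ x i) : ∏ l, ((x l : ℝ) + L) ≤
      (2 * (r + 1)) ^ Fintype.card ι * (4 * (r + 1)) * #(Icc 0 (stepBox i r x)) := by
  have hr : (0 : ℝ) < r + 1 := by positivity
  calc ∏ l, ((x l : ℝ) + L) ≤ ∏ l, (2 * ((r : ℝ) + 1) * (if l = i then 4 * ((r : ℝ) + 1) else 1) *
        ((stepBox i r x l : ℝ) + 1)) := by
        refine Finset.prod_le_prod (fun l _ ↦ by positivity) fun l _ ↦ ?_
        by_cases hl : l = i
        · subst hl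
          have : x l < 4 * (r + 1) ^ 2 * (x l / (4 * (r + 1) ^ 2) + 1) :=
            Nat.lt_mul_div_succ _ (by positivity)
          have h2 : (x l : ℝ) < 4 * ((r : ℝ) + 1) ^ 2 * (stepBox l r x l + 1) := by
            rw [stepBox, if_pos rfl]; exact_mod_cast this
          rw [if_pos rfl]
          nlinarith
        · have : x l < (r + 1) * (x l / (r + 1) + 1) := Nat.lt_mul_div_succ _ (by positivity)
          have h2 : (x l : ℝ) < ((r : ℝ) + 1) * (stepBox i r x l + 1) := by
            rw [stepBox, if_neg hl]; exact_mod_cast this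
          have h3 : (0 : ℝ) ≤ stepBox i r x l := by positivity
          rw [if_neg hl]
          nlinarith
    _ = _ := by
        rw [Finset.prod_mul_distrib, Finset.prod_mul_distrib, Finset.prod_const,
          Finset.prod_ite_eq' Finset.univ i, if_pos (Finset.mem_univ i), Finset.card_univ,
          Pi.card_Icc]
        simp

end Hitting

/-! ### Choice of parameters above the threshold -/

section Covering

open Finset

theorem tendsto_log_inv_unitInterval :
    Tendsto (fun p : I ↦ Real.log (p : ℝ)⁻¹) (𝓝[>] (0 : I)) atTop := by
  refine Real.tendsto_log_atTop.comp (tendsto_inv_nhdsGT_zero.comp ?_)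
  refine tendsto_nhdsWithin_iff.2 ⟨?_, ?_⟩
  · exact (continuous_subtype_val.tendsto' (0 : I) 0 rfl).mono_left nhdsWithin_le_nhds
  · filter_upwards [self_mem_nhdsWithin] with p hp
    exact_mod_cast hp

theorem eventually_const_mul_pow_le_exp (a : ℝ) (b : ℕ) {c : ℝ} (hc : 0 < c) :
    ∀ᶠ L : ℝ in atTop, a * L ^ b ≤ Real.exp (c * L) := by
  have h := (isLittleO_pow_exp_pos_mul_atTop b hc).const_mul_left a
  filter_upwards [h.bound one_pos] with L hL
  rw [one_mul, Real.norm_of_nonneg (Real.exp_pos _).le] at hL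
  exact (le_abs_self _).trans hL

set_option maxHeartbeats 400000 in
theorem exists_setBernoulli_notMem_generatedSemigroup_le (d : ℕ) (hd : 1 ≤ d) (K : ℕ) :
    ∃ C : ℝ, 1 ≤ C ∧ ∀ᶠ p : I in 𝓝[>] (0 : I), ∀ x : Fin d → ℕ,
      C * thresholdScale d (p : ℝ) < ∏ i, ((x i : ℝ) + Real.log (p : ℝ)⁻¹) →
      setBernoulli (Set.univ : Set (Fin d → ℕ)) p {A | x ∉ generatedSemigroup A} ≤
        ENNReal.ofReal (2 * (p : ℝ) ^ K) := by
  set η : ℝ := 1 / (64 * 4 ^ d) with hη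
  have hη0 : 0 < η := by positivity
  have hη1 : η ≤ 1 := by
    rw [hη, div_le_one (by positivity)]
    have : (1 : ℝ) ≤ 4 ^ d := one_le_pow₀ (by norm_num)
    linarith
  -- Chosen so that r + 1 ≤ R L for the number r of rounds fixed below.
  set R : ℝ := (3 * K + 4) / η + 2 with hR
  have hR0 : 1 ≤ R := by
    have : 0 ≤ (3 * K + 4) / η := by positivity
    linarith
  refine ⟨8 * (2 ^ d * 4 * R ^ (d + 1)), ?_, ?_⟩
  · have h1 : (1 : ℝ) ≤ 2 ^ d := one_le_pow₀ (by norm_num)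
    have h2 : 1 ≤ R ^ (d + 1) := one_le_pow₀ hR0
    nlinarith
  filter_upwards [self_mem_nhdsWithin, tendsto_log_inv_unitInterval.eventually_ge_atTop 1,
    tendsto_log_inv_unitInterval.eventually
      (eventually_const_mul_pow_le_exp ((2 * R ^ 2 + 1) ^ d) (2 * d) one_pos)] with p hp hL1 hexp x hx
  have h0 : (0 : ℝ) < p := by exact_mod_cast hp
  have h1 : (p : ℝ) ≤ 1 := p.2.2
  set L := Real.log (p : ℝ)⁻¹ with hL
  have hpinv : Real.exp L = (p : ℝ)⁻¹ := Real.exp_log (by positivity)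
  have hpexp : Real.exp (-L) = p := by rw [Real.exp_neg, hpinv, inv_inv]
  have hT : thresholdScale d (p : ℝ) = (p : ℝ)⁻¹ * L ^ (d + 1) := rfl
  obtain ⟨i, hi⟩ : ∃ i, ∀ l, x l ≤ x i := by
    have : Nonempty (Fin d) := ⟨⟨0, hd⟩⟩
    exact Finite.exists_max x
  set s := ⌊(p : ℝ)⁻¹⌋₊ with hs
  have hinv1 : 1 ≤ (p : ℝ)⁻¹ := (one_le_inv₀ h0).2 h1
  have hs1 : 1 ≤ s := Nat.le_floor (by simpa using hinv1)
  have hs_le : (s : ℝ) ≤ (p : ℝ)⁻¹ := Nat.floor_le (by positivity)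
  have hps : (p : ℝ) * s ≤ 1 := by
    calc (p : ℝ) * s ≤ p * (p : ℝ)⁻¹ := by gcongr
      _ = 1 := mul_inv_cancel₀ h0.ne'
  have hps' : 1 / 2 ≤ (p : ℝ) * s := by
    have h2 : (p : ℝ)⁻¹ < s + 1 := Nat.lt_floor_add_one _
    have h3 : (1 : ℝ) ≤ s := by exact_mod_cast hs1
    have h4 : (p : ℝ) * (p : ℝ)⁻¹ ≤ p * (2 * s) := by gcongr; linarith
    rw [mul_inv_cancel₀ h0.ne'] at h4
    linarith
  -- 4^L ≥ e^L = 1/p, so k₁ doublings reach size s. The k₂ further successes give s k₂ trials, and p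
  -- s ≥ 1/2 bounds their joint failure by e^(-k₂/2) ≤ p^K.
  set k₁ := ⌈2 * L⌉₊ with hk₁
  set k₂ := ⌈2 * (K * L)⌉₊ with hk₂
  have hk₁l : 2 * L ≤ k₁ := Nat.le_ceil _
  have hk₁u : (k₁ : ℝ) < 2 * L + 1 := Nat.ceil_lt_add_one (by positivity)
  have hk₂l : 2 * (K * L) ≤ k₂ := Nat.le_ceil _
  have hk₂u : (k₂ : ℝ) < 2 * (K * L) + 1 := Nat.ceil_lt_add_one (by positivity)
  set n := k₁ + k₂ with hn
  have hnR : (n : ℝ) ≤ (2 * K + 4) * L := by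
    rw [hn]; push_cast; nlinarith
  -- Makes 2^n (1 - η)^r ≤ e^(n - ηr) ≤ p^K.
  set r := ⌈((n : ℝ) + K * L) / η⌉₊ with hr
  have hrl : ((n : ℝ) + K * L) / η ≤ r := Nat.le_ceil _
  have hru : (r : ℝ) < ((n : ℝ) + K * L) / η + 1 := Nat.ceil_lt_add_one (by positivity)
  have hrR : (r : ℝ) + 1 ≤ R * L := by
    have : ((n : ℝ) + K * L) / η ≤ (3 * K + 4) / η * L := by
      rw [div_mul_eq_mul_div]; gcongr; linarith
    rw [hR, add_mul]; linarith
  clear_value s k₁ k₂ n r L η R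
  have hrη : (n : ℝ) + K * L ≤ η * r := by
    rw [div_le_iff₀ hη0] at hrl; linarith
  have hLr : L ≤ r + 1 := by
    have h2 : (n : ℝ) + K * L ≤ r := by
      have : η * r ≤ 1 * r := by gcongr
      linarith
    have h3 : (k₁ : ℝ) ≤ n := by rw [hn]; push_cast; linarith [Nat.cast_nonneg (α := ℝ) k₂]
    have h4 : 0 ≤ K * L := by positivity
    linarith
  have hk₁s : s ≤ 2 ^ k₁ := by
    have h2 : Real.exp L ≤ 2 ^ k₁ := by
      have h3 : Real.exp 1 ≤ 4 := by linarith [Real.exp_one_lt_d9]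
      calc Real.exp L = Real.exp 1 ^ L := by rw [← Real.exp_mul, one_mul]
        _ ≤ 4 ^ L := Real.rpow_le_rpow (Real.exp_pos _).le h3 (by linarith)
        _ = (2 : ℝ) ^ (2 * L) := by
          rw [Real.rpow_mul (by norm_num)]; norm_num
        _ ≤ (2 : ℝ) ^ (k₁ : ℝ) := Real.rpow_le_rpow_of_exponent_le (by norm_num) hk₁l
        _ = 2 ^ k₁ := Real.rpow_natCast _ _
    have : (s : ℝ) ≤ 2 ^ k₁ := hs_le.trans (hpinv ▸ h2)
    exact_mod_cast this
  have hCT : (p : ℝ)⁻¹ * L ^ (d + 1) * (8 * (2 ^ d * 4 * R ^ (d + 1))) < ∏ l, ((x l : ℝ) + L) := by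
    rw [hT] at hx; linarith
  -- Otherwise every coordinate is O(L²), so the product is polylogarithmic in 1/p and below the
  -- threshold.
  have hxr : 2 * (r + 1) ^ 2 ≤ x i := by
    by_contra! hlt
    have hlt' : (x i : ℝ) ≤ 2 * R ^ 2 * L ^ 2 := by
      have h2 : (x i : ℝ) ≤ 2 * ((r : ℝ) + 1) ^ 2 := by exact_mod_cast hlt.le
      have h3 : ((r : ℝ) + 1) ^ 2 ≤ (R * L) ^ 2 := by gcongr
      rw [mul_pow] at h3
      linarith
    have h2 : ∏ l, ((x l : ℝ) + L) ≤ ∏ l : Fin d, ((2 * R ^ 2 + 1) * L ^ 2) := by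
      refine Finset.prod_le_prod (fun l _ ↦ by positivity) fun l _ ↦ ?_
      have : (x l : ℝ) ≤ x i := by exact_mod_cast hi l
      have : L ≤ L ^ 2 := le_self_pow₀ hL1 two_ne_zero
      linarith
    rw [Finset.prod_const, Finset.card_univ, Fintype.card_fin, mul_pow, ← pow_mul] at h2
    rw [one_mul, hpinv] at hexp
    have h3 : (p : ℝ)⁻¹ * 1 ≤ (p : ℝ)⁻¹ * L ^ (d + 1) * (8 * (2 ^ d * 4 * R ^ (d + 1))) := by
      rw [mul_assoc]
      gcongr
      have h4 : 1 ≤ L ^ (d + 1) := one_le_pow₀ hL1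
      have h5 : (1 : ℝ) ≤ 2 ^ d := one_le_pow₀ (by norm_num)
      have h6 : 1 ≤ R ^ (d + 1) := one_le_pow₀ hR0
      have h7 : 1 ≤ 2 ^ d * R ^ (d + 1) := one_le_mul_of_one_le_of_one_le h5 h6
      exact one_le_mul_of_one_le_of_one_le h4 (by linarith)
    linarith
  have hLx : L ≤ x i := by
    have h2 : r + 1 ≤ x i := by linarith [Nat.le_self_pow two_ne_zero (r + 1)]
    have : (r : ℝ) + 1 ≤ x i := by exact_mod_cast h2
    linarith
  have hbox := prod_add_le_mul_card_stepBox i r x (by linarith) hLr hLx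
  rw [Fintype.card_fin] at hbox
  set Q : ℝ := (#(Icc 0 (stepBox i r x)) : ℝ) with hQ
  have hQ0 : 0 ≤ Q := by positivity
  clear_value Q
  have hq : 8 ≤ (p : ℝ) * Q := by
    have h2 : (2 * ((r : ℝ) + 1)) ^ d * (4 * ((r : ℝ) + 1)) * Q ≤
        2 ^ d * 4 * R ^ (d + 1) * L ^ (d + 1) * Q := by
      have h3 : (2 * ((r : ℝ) + 1)) ^ d * (4 * ((r : ℝ) + 1)) =
          2 ^ d * 4 * ((r : ℝ) + 1) ^ (d + 1) := by rw [mul_pow]; ring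
      rw [h3, mul_assoc (2 ^ d * 4) (R ^ (d + 1)), ← mul_pow]
      gcongr
    have h4 : (2 ^ d * 4 * R ^ (d + 1) * L ^ (d + 1)) * ((p : ℝ)⁻¹ * 8) <
        (2 ^ d * 4 * R ^ (d + 1) * L ^ (d + 1)) * Q := by
      calc _ = (p : ℝ)⁻¹ * L ^ (d + 1) * (8 * (2 ^ d * 4 * R ^ (d + 1))) := by ring
        _ < _ := hCT
        _ ≤ _ := hbox.trans h2
    have h5 := lt_of_mul_lt_mul_left h4 (by positivity)
    rw [inv_mul_lt_iff₀ h0] at h5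
    exact h5.le
  have hmain := setBernoulli_notMem_closure_le_of_stepBox p h0 i r n hxr (hQ ▸ hq) hs1 hps k₁ hk₁s
  rw [Fintype.card_fin, ← hη] at hmain
  refine hmain.trans (ENNReal.ofReal_le_ofReal ?_)
  have hpK : (p : ℝ) ^ K = Real.exp (-(K * L)) := by
    rw [← hpexp, ← Real.exp_nat_mul]; ring_nf
  have e1 : 2 ^ n * (1 - η) ^ r ≤ (p : ℝ) ^ K := by
    have h2 : (2 : ℝ) ^ n ≤ Real.exp n := by
      rw [← Real.exp_one_pow]
      gcongr
      linarith [Real.exp_one_gt_d9]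
    have h3 : (1 - η) ^ r ≤ Real.exp (-(η * r)) := by
      calc (1 - η) ^ r ≤ Real.exp (-η) ^ r :=
            pow_le_pow_left₀ (by linarith) (by linarith [Real.add_one_le_exp (-η)]) r
        _ = Real.exp (-(η * r)) := by rw [← Real.exp_nat_mul]; ring_nf
    calc 2 ^ n * (1 - η) ^ r ≤ Real.exp n * Real.exp (-(η * r)) :=
          mul_le_mul h2 h3 (pow_nonneg (by linarith) _) (Real.exp_pos _).le
      _ ≤ (p : ℝ) ^ K := by
          rw [← Real.exp_add, hpK]
          exact Real.exp_le_exp.2 (by linarith)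
  have e2 : (1 - (p : ℝ)) ^ (s * (n - k₁)) ≤ (p : ℝ) ^ K := by
    rw [show n - k₁ = k₂ by omega, hpK]
    calc (1 - (p : ℝ)) ^ (s * k₂) ≤ Real.exp (-p) ^ (s * k₂) :=
          pow_le_pow_left₀ (by linarith) (by linarith [Real.add_one_le_exp (-(p : ℝ))]) _
      _ = Real.exp (-((p * s) * k₂)) := by rw [← Real.exp_nat_mul]; push_cast; ring_nf
      _ ≤ _ := Real.exp_le_exp.2 (by
        have := mul_le_mul_of_nonneg_right hps' (Nat.cast_nonneg (α := ℝ) k₂)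
        linarith)
  linarith

end Covering

/-! ### Counting lattice points under the hyperboloid -/

section RegionCount

open Finset

theorem le_prod_add {d : ℕ} {L : ℝ} (hL : 1 ≤ L) (x : Fin d → ℕ) (l : Fin d) :
    (x l : ℝ) + L ≤ ∏ i, ((x i : ℝ) + L) := by
  rw [← Finset.mul_prod_erase _ _ (Finset.mem_univ l)]
  refine le_mul_of_one_le_right (by positivity) ?_
  rw [← Finset.prod_const_one (s := Finset.univ.erase l)]
  refine Finset.prod_le_prod (fun _ _ ↦ zero_le_one) fun i _ ↦ ?_
  linarith [Nat.cast_nonneg (α := ℝ) (x i)]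

/-- The points of `hyperboloidRegion d p Z`, where `L = log p⁻¹`, as a finite set. -/
noncomputable def regionFinset (d : ℕ) (L Z : ℝ) : Finset (Fin d → ℕ) :=
  (Fintype.piFinset fun _ : Fin d ↦ Finset.range (⌊Z⌋₊ + 1)).filter
    fun x ↦ ∏ i, ((x i : ℝ) + L) ≤ Z

theorem mem_regionFinset {d : ℕ} {L Z : ℝ} (hL : 1 ≤ L) {x : Fin d → ℕ} :
    x ∈ regionFinset d L Z ↔ ∏ i, ((x i : ℝ) + L) ≤ Z := by
  rw [regionFinset, Finset.mem_filter, and_iff_right_iff_imp]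
  intro h
  rw [Fintype.mem_piFinset]
  intro l
  rw [Finset.mem_range, Nat.lt_succ_iff]
  refine Nat.le_floor ?_
  have := le_prod_add hL x l
  linarith

theorem coe_regionFinset {d : ℕ} {p Z : ℝ} (hL : 1 ≤ Real.log p⁻¹) :
    (regionFinset d (Real.log p⁻¹) Z : Set (Fin d → ℕ)) = hyperboloidRegion d p Z := by
  ext x
  exact mem_regionFinset hL

theorem card_regionFinset_le_pow (d : ℕ) (L : ℝ) {Z : ℝ} (hZ : 0 ≤ Z) :
    (#(regionFinset d L Z) : ℝ) ≤ (Z + 1) ^ d := by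
  have h : #(regionFinset d L Z) ≤ (⌊Z⌋₊ + 1) ^ d := by
    refine (Finset.card_filter_le _ _).trans ?_
    simp
  calc (#(regionFinset d L Z) : ℝ) ≤ ((⌊Z⌋₊ : ℝ) + 1) ^ d := by exact_mod_cast h
    _ ≤ (Z + 1) ^ d := by gcongr; exact Nat.floor_le hZ

theorem sum_piFinset_prod_eq_pow (m : ℕ) (s : Finset ℕ) (g : ℕ → ℝ) :
    ∑ y ∈ Fintype.piFinset fun _ : Fin m ↦ s, ∏ i, g (y i) = (∑ a ∈ s, g a) ^ m := by
  have := Finset.prod_univ_sum (fun _ : Fin m ↦ s) (fun _ a ↦ g a)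
  simpa using this.symm

/-- Once the last m coordinates y are fixed, the first takes at most Z / ∏ (yᵢ + L) values; L ≥ 1
absorbs the value 0. Summing over y factors into a power of a harmonic sum. -/
theorem card_regionFinset_succ_le (m : ℕ) {L Z : ℝ} (hL : 1 ≤ L) (hZ : 0 ≤ Z) :
    (#(regionFinset (m + 1) L Z) : ℝ) ≤
      Z * (∑ y ∈ Finset.range (⌊Z⌋₊ + 1), ((y : ℝ) + L)⁻¹) ^ m := by
  have hmaps : ∀ x ∈ regionFinset (m + 1) L Z,
      Fin.tail x ∈ Fintype.piFinset fun _ : Fin m ↦ Finset.range (⌊Z⌋₊ + 1) := by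
    intro x hx
    have := (Finset.mem_filter.1 hx).1
    rw [Fintype.mem_piFinset] at this ⊢
    exact fun l ↦ this l.succ
  have hfib (y : Fin m → ℕ) :
      (#((regionFinset (m + 1) L Z).filter fun x ↦ Fin.tail x = y) : ℝ) ≤
        Z * ∏ i, ((y i : ℝ) + L)⁻¹ := by
    have hpos : 0 < ∏ i, ((y i : ℝ) + L) := Finset.prod_pos fun i _ ↦ by positivity
    have hcard : #((regionFinset (m + 1) L Z).filter fun x ↦ Fin.tail x = y) ≤
        #(Finset.range ⌊Z * ∏ i, ((y i : ℝ) + L)⁻¹⌋₊) := by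
      refine Finset.card_le_card_of_injOn (fun x ↦ x 0) (fun x hx ↦ ?_) fun x hx x' hx' h ↦ ?_
      · obtain ⟨hx1, rfl⟩ := Finset.mem_filter.1 hx
        rw [mem_regionFinset hL, Fin.prod_univ_succ] at hx1
        rw [Finset.coe_range, Set.mem_Iio]
        refine Nat.lt_of_succ_le (Nat.le_floor ?_)
        rw [Finset.prod_inv_distrib, ← div_eq_mul_inv, le_div_iff₀ hpos]
        push_cast
        refine le_trans ?_ hx1
        exact mul_le_mul_of_nonneg_right (by simpa using hL) hpos.le
      · obtain ⟨-, rfl⟩ := Finset.mem_filter.1 hx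
        obtain ⟨-, h'⟩ := Finset.mem_filter.1 hx'
        rw [← Fin.cons_self_tail x, ← Fin.cons_self_tail x', h']
        exact congrArg (fun a ↦ Fin.cons (α := fun _ ↦ ℕ) a (Fin.tail x)) h
    rw [Finset.card_range] at hcard
    refine le_trans (by exact_mod_cast hcard) (Nat.floor_le ?_)
    rw [Finset.prod_inv_distrib]
    positivity
  rw [Finset.card_eq_sum_card_fiberwise hmaps]
  push_cast
  refine (Finset.sum_le_sum fun y _ ↦ hfib y).trans ?_
  rw [← Finset.mul_sum, sum_piFinset_prod_eq_pow m _ fun a ↦ ((a : ℝ) + L)⁻¹]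

/-- For y in the cube [0, Y)^m, `hY` ensures that subtracting L costs at most half of the fibre
length Z / ∏ (yᵢ + L). -/
theorem le_card_regionFinset_succ (m : ℕ) {L Z : ℝ} (hL : 1 ≤ L) (Y : ℕ)
    (hY : 2 * L * (Y + L) ^ m ≤ Z) :
    Z / 2 * (∑ y ∈ Finset.range Y, ((y : ℝ) + L)⁻¹) ^ m ≤ #(regionFinset (m + 1) L Z) := by
  have hprod (y : Fin m → ℕ) : 0 < ∏ i, ((y i : ℝ) + L) := Finset.prod_pos fun i _ ↦ by positivity
  have hbig : ∀ y ∈ Fintype.piFinset fun _ : Fin m ↦ Finset.range Y,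
      2 * L * ∏ i, ((y i : ℝ) + L) ≤ Z := by
    intro y hy
    refine le_trans ?_ hY
    gcongr
    calc ∏ i, ((y i : ℝ) + L) ≤ ∏ i : Fin m, ((Y : ℝ) + L) := by
          refine Finset.prod_le_prod (fun i _ ↦ by positivity) fun i _ ↦ ?_
          have := Finset.mem_range.1 (Fintype.mem_piFinset.1 hy i)
          gcongr
      _ = _ := by simp
  have hcard : #((Fintype.piFinset fun _ : Fin m ↦ Finset.range Y).sigma fun y ↦
      Finset.range (⌊Z * ∏ i, ((y i : ℝ) + L)⁻¹ - L⌋₊ + 1)) ≤ #(regionFinset (m + 1) L Z) := by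
    refine Finset.card_le_card_of_injOn (fun a ↦ Fin.cons a.2 a.1) (fun a ha ↦ ?_)
      fun a _ a' _ h ↦ ?_
    · obtain ⟨h1, h2⟩ := Finset.mem_sigma.1 ha
      refine Finset.mem_coe.2 ((mem_regionFinset hL).2 ?_)
      have h3 := hbig _ h1
      have hp := hprod a.1
      have h4 : 0 ≤ Z * ∏ i, ((a.1 i : ℝ) + L)⁻¹ - L := by
        rw [sub_nonneg, Finset.prod_inv_distrib, ← div_eq_mul_inv, le_div_iff₀ hp]
        nlinarith
      have h5 : (a.2 : ℝ) ≤ Z * ∏ i, ((a.1 i : ℝ) + L)⁻¹ - L := by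
        refine le_trans ?_ (Nat.floor_le h4)
        exact_mod_cast Nat.lt_succ_iff.1 (Finset.mem_range.1 h2)
      have h6 : (a.2 : ℝ) + L ≤ Z / ∏ i, ((a.1 i : ℝ) + L) := by
        rw [Finset.prod_inv_distrib, ← div_eq_mul_inv] at h5; linarith
      rw [le_div_iff₀ hp] at h6
      rw [Fin.prod_univ_succ]
      simpa using h6
    · obtain ⟨h1, h2⟩ := Fin.cons_injective2 h
      obtain ⟨a1, a2⟩ := a
      obtain ⟨a1', a2'⟩ := a'
      simp only at h1 h2
      subst h1 h2
      rfl
  rw [Finset.card_sigma] at hcard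
  refine le_trans ?_ ((Nat.cast_le (α := ℝ)).2 hcard)
  rw [← sum_piFinset_prod_eq_pow, Finset.mul_sum]
  push_cast
  refine Finset.sum_le_sum fun y hy ↦ ?_
  rw [Finset.card_range]
  push_cast
  refine le_trans ?_ (Nat.lt_floor_add_one _).le
  have h3 := hbig y hy
  rw [Finset.prod_inv_distrib]
  have h4 : 2 * L ≤ Z * (∏ i, ((y i : ℝ) + L))⁻¹ := by
    rwa [← div_eq_mul_inv, le_div_iff₀ (hprod y)]
  linarith

theorem sum_range_inv_add_le {L : ℝ} (hL : 1 ≤ L) (M : ℕ) :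
    ∑ y ∈ Finset.range M, ((y : ℝ) + L)⁻¹ ≤ 1 + Real.log M := by
  refine le_trans ?_ (harmonic_le_one_add_log M)
  rw [harmonic]
  push_cast
  refine Finset.sum_le_sum fun y _ ↦ ?_
  gcongr

theorem log_sub_log_le_sum_range_inv_add {L : ℝ} (hL : 0 < L) (M : ℕ) :
    Real.log (M + L) - Real.log L ≤ ∑ y ∈ Finset.range M, ((y : ℝ) + L)⁻¹ := by
  induction M with
  | zero => simp
  | succ M ih =>
    rw [Finset.sum_range_succ]
    have hpos : 0 < (M : ℝ) + L := by positivity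
    have h : Real.log (((M + 1 : ℕ) : ℝ) + L) - Real.log (M + L) ≤ ((M : ℝ) + L)⁻¹ := by
      rw [← Real.log_div (by positivity) hpos.ne']
      refine (Real.log_le_sub_one_of_pos (by positivity)).trans (le_of_eq ?_)
      push_cast
      field_simp
      ring
    linarith

theorem exists_card_regionFinset_bounds (d : ℕ) (hd : 1 ≤ d) {κ : ℝ} (hκ : 0 < κ) :
    ∃ a b : ℝ, 0 < a ∧ 0 < b ∧ ∀ᶠ L : ℝ in atTop,
      a * (Real.exp L * L ^ (2 * d)) ≤ #(regionFinset d L (κ * (Real.exp L * L ^ (d + 1)))) ∧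
      (#(regionFinset d L (κ * (Real.exp L * L ^ (d + 1)))) : ℝ) ≤
        b * (Real.exp L * L ^ (2 * d)) := by
  obtain ⟨m, rfl⟩ : ∃ m, d = m + 1 := ⟨d - 1, by omega⟩
  set D : ℝ := ((m + 1 : ℕ) : ℝ) with hD
  have hD0 : 0 < D := by positivity
  refine ⟨κ / 2 * (1 / (4 * D)) ^ m, κ * 3 ^ m, by positivity, by positivity, ?_⟩
  filter_upwards [eventually_ge_atTop 1,
    eventually_const_mul_pow_le_exp (κ + 1) (m + 2) one_pos,
    eventually_const_mul_pow_le_exp 1 1 (by positivity : 0 < 1 / (4 * D)),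
    eventually_const_mul_pow_le_exp 1 1 (by positivity : 0 < 1 / (2 * D)),
    eventually_const_mul_pow_le_exp 3 0 (by positivity : 0 < 1 / (2 * D)),
    eventually_const_mul_pow_le_exp (2 / κ) 0 (by positivity : 0 < 1 / D)]
    with L hL h1 h2 h3 h4 h5
  set Z := κ * (Real.exp L * L ^ (m + 1 + 1)) with hZ
  have hZ0 : 0 ≤ Z := by positivity
  rw [one_mul, pow_one] at h2 h3
  rw [pow_zero, mul_one] at h4 h5
  have hexpD : Real.exp (1 / (2 * D) * L) * Real.exp (1 / (2 * D) * L) = Real.exp (1 / D * L) := by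
    rw [← Real.exp_add]; congr 1; field_simp; norm_num
  have hexpm : Real.exp (1 / D * L) ^ m * Real.exp (1 / D * L) = Real.exp L := by
    rw [← pow_succ, ← Real.exp_nat_mul]; congr 1; rw [← hD]; field_simp
  constructor
  -- Small enough that (Y + L)^m ≤ e^(mL/D), with a factor e^(L/D) to spare, and large enough that
  -- log Y is of order L.
  · set Y := ⌊Real.exp (1 / (2 * D) * L)⌋₊ + 1 with hY
    have hY1 : Real.exp (1 / (2 * D) * L) ≤ Y := by
      rw [hY]; push_cast; exact (Nat.lt_floor_add_one _).le
    have hY2 : (Y : ℝ) ≤ Real.exp (1 / (2 * D) * L) + 1 := by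
      rw [hY]; push_cast; gcongr; exact Nat.floor_le (Real.exp_pos _).le
    have hYL : (Y : ℝ) + L ≤ Real.exp (1 / D * L) := by
      rw [← hexpD]; nlinarith
    have hY3 : 2 * L * (Y + L) ^ m ≤ Z := by
      have e1 : 2 ≤ κ * Real.exp (1 / D * L) := by
        rw [div_le_iff₀ hκ] at h5; linarith
      have e2 : L ≤ L ^ (m + 1 + 1) := le_self_pow₀ hL (by omega)
      calc 2 * L * (Y + L) ^ m ≤ (κ * Real.exp (1 / D * L)) * L ^ (m + 1 + 1) *
            Real.exp (1 / D * L) ^ m := by gcongr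
        _ = Z := by rw [hZ, ← hexpm]; ring
    refine le_trans ?_ (le_card_regionFinset_succ m hL Y hY3)
    have hlog : 1 / (4 * D) * L ≤ ∑ y ∈ Finset.range Y, ((y : ℝ) + L)⁻¹ := by
      refine le_trans ?_ (log_sub_log_le_sum_range_inv_add (by linarith) Y)
      have e1 : 1 / (2 * D) * L ≤ Real.log (Y + L) := by
        rw [Real.le_log_iff_exp_le (by positivity)]; linarith
      have e2 : Real.log L ≤ 1 / (4 * D) * L := by
        rw [Real.log_le_iff_le_exp (by linarith)]; exact h2
      have e3 : 1 / (2 * D) * L = 1 / (4 * D) * L + 1 / (4 * D) * L := by field_simp; norm_num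
      linarith
    calc κ / 2 * (1 / (4 * D)) ^ m * (Real.exp L * L ^ (2 * (m + 1)))
        = Z / 2 * (1 / (4 * D) * L) ^ m := by rw [hZ, mul_pow]; ring
      _ ≤ _ := by gcongr
  · refine (card_regionFinset_succ_le m hL hZ0).trans ?_
    have hlog : ∑ y ∈ Finset.range (⌊Z⌋₊ + 1), ((y : ℝ) + L)⁻¹ ≤ 3 * L := by
      refine (sum_range_inv_add_le hL _).trans ?_
      have e1 : Real.log ((⌊Z⌋₊ + 1 : ℕ) : ℝ) ≤ 2 * L := by
        rw [Real.log_le_iff_le_exp (by positivity)]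
        push_cast
        have e2 : 1 ≤ L ^ (m + 1 + 1) := one_le_pow₀ hL
        have e3 : 1 ≤ Real.exp L := Real.one_le_exp (by linarith)
        have e4 : 1 ≤ Real.exp L * L ^ (m + 1 + 1) := one_le_mul_of_one_le_of_one_le e3 e2
        rw [one_mul] at h1
        calc (⌊Z⌋₊ : ℝ) + 1 ≤ Z + 1 * (Real.exp L * L ^ (m + 1 + 1)) := by
              gcongr
              · exact Nat.floor_le hZ0
              · linarith
          _ = Real.exp L * ((κ + 1) * L ^ (m + 2)) := by rw [hZ]; ring
          _ ≤ Real.exp L * Real.exp L := by gcongr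
          _ = Real.exp (2 * L) := by rw [← Real.exp_add]; ring_nf
      linarith
    calc Z * (∑ y ∈ Finset.range (⌊Z⌋₊ + 1), ((y : ℝ) + L)⁻¹) ^ m ≤ Z * (3 * L) ^ m := by
          gcongr
      _ = _ := by rw [hZ, mul_pow]; ring

end RegionCount

/-! ### From a dyadic shell to the whole complement -/

section Gaps

open Finset

theorem half_add_le {L : ℝ} (hL : 1 ≤ L) (a : ℕ) : ((a : ℝ) + L) / 2 ≤ ((a / 2 : ℕ) : ℝ) + L := by
  have : a ≤ 2 * (a / 2) + 1 := by omega
  have h : (a : ℝ) ≤ 2 * ((a / 2 : ℕ) : ℝ) + 1 := by exact_mod_cast this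
  linarith

/-- If an additive submonoid contains the points `x` with `Z < ∏ (xᵢ + L) ≤ 2 ^ d * Z`, then it
contains all points with `Z < ∏ (xᵢ + L)`. -/
theorem mem_of_forall_dyadic_shell {d : ℕ} {L Z : ℝ} (hL : 1 ≤ L) (hZ : L ^ d ≤ Z)
    (S : AddSubmonoid (Fin d → ℕ))
    (hS : ∀ x, Z < ∏ i, ((x i : ℝ) + L) → ∏ i, ((x i : ℝ) + L) ≤ 2 ^ d * Z → x ∈ S)
    (x : Fin d → ℕ) (hx : Z < ∏ i, ((x i : ℝ) + L)) : x ∈ S := by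
  induction hN : ∑ i, x i using Nat.strong_induction_on generalizing x with
  | _ N ih =>
  subst hN
  by_cases h : ∏ i, ((x i : ℝ) + L) ≤ 2 ^ d * Z
  · exact hS x hx h
  rw [not_le] at h
  set y : Fin d → ℕ := fun i ↦ x i / 2 with hy
  set z : Fin d → ℕ := fun i ↦ x i - x i / 2 with hz
  have hxyz : x = y + z := by
    ext i; simp only [hy, hz, Pi.add_apply]; omega
  have hyN : Z < ∏ i, ((y i : ℝ) + L) := by
    have h1 : ∏ i, (((x i : ℝ) + L) / 2) ≤ ∏ i, ((y i : ℝ) + L) :=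
      Finset.prod_le_prod (fun i _ ↦ by positivity) fun i _ ↦ half_add_le hL (x i)
    rw [Finset.prod_div_distrib, Finset.prod_const, Finset.card_univ, Fintype.card_fin] at h1
    refine lt_of_lt_of_le ?_ h1
    rw [lt_div_iff₀ (by positivity)]
    linarith
  have hyz : y ≤ z := fun i ↦ by simp only [hy, hz]; omega
  have hzN : Z < ∏ i, ((z i : ℝ) + L) := by
    refine hyN.trans_le (Finset.prod_le_prod (fun i _ ↦ by positivity) fun i _ ↦ ?_)
    have := hyz i
    gcongr
  -- If y = 0 the product is L^d ≤ Z, a contradiction. Thus both halves are smaller than x and the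
  -- induction applies.
  have hysum : 0 < ∑ i, y i := by
    by_contra! h0
    have h1 : ∀ i, y i = 0 := by simpa using h0
    simp only [h1, Nat.cast_zero, zero_add, Finset.prod_const, Finset.card_univ,
      Fintype.card_fin] at hyN
    linarith
  have hsum : ∑ i, x i = ∑ i, y i + ∑ i, z i := by
    rw [← Finset.sum_add_distrib]; exact Finset.sum_congr rfl fun i _ ↦ congrFun hxyz i
  have hle : ∑ i, y i ≤ ∑ i, z i := Finset.sum_le_sum fun i _ ↦ hyz i
  rw [hxyz]
  exact add_mem (ih _ (by omega) y hyN rfl) (ih _ (by omega) z hzN rfl)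

theorem exists_tendsto_setBernoulli_not_compl_subset (d : ℕ) (hd : 1 ≤ d) :
    ∃ C₀ : ℝ, 1 ≤ C₀ ∧ ∀ C, C₀ ≤ C → Tendsto
      (fun p : I ↦ setBernoulli (Set.univ : Set (Fin d → ℕ)) p
        {A | ¬ (hyperboloidRegion d (p : ℝ) (C * thresholdScale d (p : ℝ)))ᶜ ⊆
          generatedSemigroup A}) (𝓝[>] (0 : I)) (𝓝 0) := by
  -- The shell has at most p^(-2d) points, so the exponent 2d + 1 leaves a total failure probability
  -- of 2p.
  obtain ⟨C₀, hC₀, hev⟩ := exists_setBernoulli_notMem_generatedSemigroup_le d hd (2 * d + 1)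
  refine ⟨C₀, hC₀, fun C hC ↦ ?_⟩
  have hp0 : Tendsto (fun p : I ↦ ENNReal.ofReal (2 * (p : ℝ))) (𝓝[>] (0 : I)) (𝓝 0) := by
    have h1 : Tendsto (fun p : I ↦ 2 * (p : ℝ)) (𝓝[>] (0 : I)) (𝓝 0) :=
      ((continuous_const.mul continuous_subtype_val).tendsto' (0 : I) 0 (by simp)).mono_left
        nhdsWithin_le_nhds
    have h2 := ENNReal.tendsto_ofReal h1
    rwa [ENNReal.ofReal_zero] at h2
  refine tendsto_of_tendsto_of_tendsto_of_le_of_le' tendsto_const_nhds hp0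
    (Eventually.of_forall fun _ ↦ zero_le) ?_
  filter_upwards [hev, self_mem_nhdsWithin, tendsto_log_inv_unitInterval.eventually_ge_atTop 1,
    tendsto_log_inv_unitInterval.eventually
      (eventually_const_mul_pow_le_exp (2 ^ d * C + 1) (d + 1) one_pos)] with p hpx hp hL1 hexp
  have h0 : (0 : ℝ) < p := by exact_mod_cast hp
  have h1 : (p : ℝ) ≤ 1 := p.2.2
  have hinv1 : 1 ≤ (p : ℝ)⁻¹ := (one_le_inv₀ h0).2 h1
  set L := Real.log (p : ℝ)⁻¹ with hL
  have hpinv : Real.exp L = (p : ℝ)⁻¹ := Real.exp_log (by positivity)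
  have hT : thresholdScale d (p : ℝ) = (p : ℝ)⁻¹ * L ^ (d + 1) := rfl
  rw [one_mul, hpinv] at hexp
  set Z := C * thresholdScale d (p : ℝ) with hZ
  have hC1 : 1 ≤ C := hC₀.trans hC
  have hT0 : 0 ≤ thresholdScale d (p : ℝ) := by rw [hT]; positivity
  have hZ0 : 0 ≤ Z := by positivity
  have hZL : L ^ d ≤ Z := by
    rw [hZ, hT]
    calc L ^ d ≤ L ^ (d + 1) := pow_le_pow_right₀ hL1 (Nat.le_succ d)
      _ = 1 * (1 * L ^ (d + 1)) := by ring
      _ ≤ C * ((p : ℝ)⁻¹ * L ^ (d + 1)) := by gcongr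
  have hsub : {A : Set (Fin d → ℕ) | ¬ (hyperboloidRegion d (p : ℝ) Z)ᶜ ⊆ generatedSemigroup A} ⊆
      ⋃ x ∈ (regionFinset d L (2 ^ d * Z)).filter (fun x ↦ Z < ∏ i, ((x i : ℝ) + L)),
        {A | x ∉ generatedSemigroup A} := by
    intro A hA
    by_contra hcon
    refine hA fun x hx ↦ ?_
    refine mem_of_forall_dyadic_shell hL1 hZL (AddSubmonoid.closure A) (fun y hy hy' ↦ ?_) x
      (not_le.1 hx)
    by_contra hyA
    refine hcon (Set.mem_biUnion (Finset.mem_coe.2 (Finset.mem_filter.2 ⟨?_, hy⟩)) hyA)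
    exact (mem_regionFinset hL1).2 hy'
  refine (MeasureTheory.measure_mono hsub).trans
    ((MeasureTheory.measure_biUnion_finset_le _ _).trans ?_)
  have hle : ∀ x ∈ (regionFinset d L (2 ^ d * Z)).filter (fun x ↦ Z < ∏ i, ((x i : ℝ) + L)),
      setBernoulli (Set.univ : Set (Fin d → ℕ)) p {A | x ∉ generatedSemigroup A} ≤
        ENNReal.ofReal (2 * (p : ℝ) ^ (2 * d + 1)) := fun x hx ↦
    hpx x (lt_of_le_of_lt (mul_le_mul_of_nonneg_right hC hT0) (Finset.mem_filter.1 hx).2)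
  refine (Finset.sum_le_sum hle).trans ?_
  rw [Finset.sum_const, nsmul_eq_mul, ← ENNReal.ofReal_natCast, ← ENNReal.ofReal_mul (by positivity)]
  refine ENNReal.ofReal_le_ofReal ?_
  have hcard : (#((regionFinset d L (2 ^ d * Z)).filter
      (fun x ↦ Z < ∏ i, ((x i : ℝ) + L))) : ℝ) ≤ ((p : ℝ)⁻¹ ^ 2) ^ d := by
    refine le_trans (Nat.cast_le.2 (Finset.card_filter_le _ _))
      ((card_regionFinset_le_pow d L (by positivity)).trans ?_)
    gcongr
    have e2 : 1 ≤ (p : ℝ)⁻¹ * L ^ (d + 1) :=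
      one_le_mul_of_one_le_of_one_le hinv1 (one_le_pow₀ hL1)
    calc 2 ^ d * Z + 1 ≤ (p : ℝ)⁻¹ * ((2 ^ d * C + 1) * L ^ (d + 1)) := by
          rw [hZ, hT]; linarith
      _ ≤ (p : ℝ)⁻¹ * (p : ℝ)⁻¹ := by gcongr
      _ = _ := (sq _).symm
  calc _ ≤ ((p : ℝ)⁻¹ ^ 2) ^ d * (2 * (p : ℝ) ^ (2 * d + 1)) := by gcongr
    _ = 2 * (p : ℝ) := by
      rw [← pow_mul, inv_pow, pow_succ]; field_simp

end Gaps

/-! ### Generating functions and square-root moments -/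

section GeneratingFunction

open Finset

theorem sum_le_sum_of_subset_image {α β : Type*} [DecidableEq β] {s : Finset β} {t : Finset α}
    {φ : α → β} (h : s ⊆ t.image φ) {f : β → ℝ} (hf : ∀ b, 0 ≤ f b) :
    ∑ b ∈ s, f b ≤ ∑ a ∈ t, f (φ a) := by
  refine (Finset.sum_le_sum_of_subset_of_nonneg h fun b _ _ ↦ hf b).trans ?_
  rw [Finset.sum_comp f φ]
  refine Finset.sum_le_sum fun b hb ↦ ?_
  obtain ⟨a, ha, rfl⟩ := Finset.mem_image.1 hb
  refine le_self_nsmul (hf _) (Finset.card_ne_zero.2 ⟨a, ?_⟩)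
  simp [ha]

theorem sqrt_sum_le_sum_sqrt {α : Type*} (s : Finset α) {f : α → ℝ} (hf : ∀ a, 0 ≤ f a) :
    √(∑ a ∈ s, f a) ≤ ∑ a ∈ s, √(f a) := by
  classical
  induction s using Finset.induction_on with
  | empty => simp
  | insert a s ha ih =>
    rw [Finset.sum_insert ha, Finset.sum_insert ha]
    have h0 : 0 ≤ ∑ b ∈ s, f b := Finset.sum_nonneg fun b _ ↦ hf b
    refine le_trans (Real.sqrt_le_iff.2 ⟨by positivity, ?_⟩) (add_le_add_right ih _)
    nlinarith [Real.sq_sqrt (hf a), Real.sq_sqrt h0, Real.sqrt_nonneg (f a),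
      Real.sqrt_nonneg (∑ b ∈ s, f b), mul_nonneg (Real.sqrt_nonneg (f a))
        (Real.sqrt_nonneg (∑ b ∈ s, f b))]

variable {ι : Type*} [Fintype ι]

/-- The monomial `∏ uₗ ^ aₗ`. -/
def monomialWeight (u : ι → ℝ) (a : ι → ℕ) : ℝ := ∏ l, u l ^ a l

theorem monomialWeight_add (u : ι → ℝ) (a b : ι → ℕ) :
    monomialWeight u (a + b) = monomialWeight u a * monomialWeight u b := by
  simp [monomialWeight, pow_add, Finset.prod_mul_distrib]

theorem monomialWeight_nsmul (u : ι → ℝ) (m : ℕ) (a : ι → ℕ) :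
    monomialWeight u (m • a) = monomialWeight u a ^ m := by
  simp [monomialWeight, pow_mul', Finset.prod_pow]

theorem monomialWeight_pos {u : ι → ℝ} (hu : ∀ l, 0 < u l) (a : ι → ℕ) :
    0 < monomialWeight u a := Finset.prod_pos fun l _ ↦ pow_pos (hu l) _

theorem monomialWeight_anti {u : ι → ℝ} (hu : ∀ l, 0 < u l) (hu1 : ∀ l, u l < 1) {a b : ι → ℕ}
    (h : a ≤ b) : monomialWeight u b ≤ monomialWeight u a :=
  Finset.prod_le_prod (fun l _ ↦ (pow_pos (hu l) _).le)
    fun l _ ↦ pow_le_pow_of_le_one (hu l).le (hu1 l).le (h l)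

theorem monomialWeight_le_pow [DecidableEq ι] {u : ι → ℝ} (hu : ∀ l, 0 < u l)
    (hu1 : ∀ l, u l < 1) (a : ι → ℕ) (i : ι) : monomialWeight u a ≤ u i ^ a i := by
  rw [monomialWeight, ← Finset.mul_prod_erase _ _ (Finset.mem_univ i)]
  refine mul_le_of_le_one_right (pow_pos (hu i) _).le ?_
  exact Finset.prod_le_one (fun l _ ↦ (pow_pos (hu l) _).le)
    fun l _ ↦ pow_le_one₀ (hu l).le (hu1 l).le

theorem monomialWeight_lt_one [DecidableEq ι] {u : ι → ℝ} (hu : ∀ l, 0 < u l)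
    (hu1 : ∀ l, u l < 1) {a : ι → ℕ} (ha : a ≠ 0) : monomialWeight u a < 1 := by
  obtain ⟨i, hi⟩ := Function.ne_iff.1 ha
  exact (monomialWeight_le_pow hu hu1 a i).trans_lt (pow_lt_one₀ (hu i).le (hu1 i) hi)

open scoped Classical in
/-- The points of the box `[0, X]` generated by `B`. -/
noncomputable def generatedInBox (X : ι → ℕ) (B : Finset (ι → ℕ)) : Finset (ι → ℕ) :=
  (Icc 0 X).filter (· ∈ AddSubmonoid.closure (B : Set (ι → ℕ)))

theorem mem_generatedInBox {X : ι → ℕ} {B : Finset (ι → ℕ)} {y : ι → ℕ} :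
    y ∈ generatedInBox X B ↔ y ≤ X ∧ y ∈ AddSubmonoid.closure (B : Set (ι → ℕ)) := by
  simp [generatedInBox]

/-- The product expands into the weights of all multisets of generators, and each generated point
has at least one such representation. In the induction the multiplicity of a is at most X i, where a
i ≠ 0. -/
theorem sum_generatedInBox_le [DecidableEq ι] {u : ι → ℝ} (hu : ∀ l, 0 < u l)
    (hu1 : ∀ l, u l < 1) (X : ι → ℕ) (B : Finset (ι → ℕ)) (hB : 0 ∉ B) :
    ∑ y ∈ generatedInBox X B, monomialWeight u y ≤ ∏ a ∈ B, (1 - monomialWeight u a)⁻¹ := by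
  induction B using Finset.induction_on with
  | empty =>
    have : generatedInBox X ∅ = {0} := by
      ext y; simp only [mem_generatedInBox, Finset.coe_empty, AddSubmonoid.closure_empty,
        AddSubmonoid.mem_bot, Finset.mem_singleton, and_iff_right_iff_imp]
      rintro rfl; exact zero_le
    simp [this, monomialWeight]
  | insert a B ha ih =>
    rw [Finset.mem_insert, not_or] at hB
    have ha0 : a ≠ 0 := Ne.symm hB.1
    obtain ⟨i, hi⟩ := Function.ne_iff.1 ha0
    have hwa := monomialWeight_lt_one hu hu1 ha0
    have hwa0 := monomialWeight_pos hu a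
    have hsub : generatedInBox X (insert a B) ⊆
        (Finset.range (X i + 1) ×ˢ generatedInBox X B).image fun x ↦ x.1 • a + x.2 := by
      intro y hy
      obtain ⟨hyX, hy⟩ := mem_generatedInBox.1 hy
      rw [Finset.coe_insert, Set.insert_eq, AddSubmonoid.closure_union, AddSubmonoid.mem_sup] at hy
      obtain ⟨y', hy', z, hz, rfl⟩ := hy
      obtain ⟨m, rfl⟩ := AddSubmonoid.mem_closure_singleton.1 hy'
      refine Finset.mem_image.2 ⟨(m, z), Finset.mem_product.2 ⟨Finset.mem_range.2 ?_,
        mem_generatedInBox.2 ⟨le_trans (le_add_of_nonneg_left zero_le) hyX, hz⟩⟩, rfl⟩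
      have h1 : m * a i + z i ≤ X i := hyX i
      have h2 : m * 1 ≤ m * a i := Nat.mul_le_mul_left _ (Nat.one_le_iff_ne_zero.2 hi)
      omega
    refine (sum_le_sum_of_subset_image hsub fun y ↦ (monomialWeight_pos hu y).le).trans ?_
    rw [Finset.prod_insert ha, Finset.sum_product]
    simp_rw [monomialWeight_add, monomialWeight_nsmul]
    rw [← Finset.sum_mul_sum]
    have hgeom : ∑ m ∈ Finset.range (X i + 1), monomialWeight u a ^ m ≤
        (1 - monomialWeight u a)⁻¹ := by
      rw [← tsum_geometric_of_lt_one hwa0.le hwa]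
      exact (summable_geometric_of_lt_one hwa0.le hwa).sum_le_tsum _
        fun m _ ↦ pow_nonneg hwa0.le m
    refine mul_le_mul hgeom (ih hB.2) (Finset.sum_nonneg fun y _ ↦ (monomialWeight_pos hu y).le) ?_
    exact inv_nonneg.2 (by linarith)

theorem sqrt_card_generatedInBox_le [DecidableEq ι] {u : ι → ℝ} (hu : ∀ l, 0 < u l)
    (hu1 : ∀ l, u l < 1) (X : ι → ℕ) (B : Finset (ι → ℕ)) (hB : 0 ∉ B) :
    √(#(generatedInBox X B) : ℝ) ≤
      (√(monomialWeight u X))⁻¹ * ∏ a ∈ B, (√(1 - monomialWeight u a))⁻¹ := by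
  have hX := monomialWeight_pos hu X
  have h1 : #(generatedInBox X B) * monomialWeight u X ≤ ∏ a ∈ B, (1 - monomialWeight u a)⁻¹ := by
    refine le_trans ?_ (sum_generatedInBox_le hu hu1 X B hB)
    rw [← nsmul_eq_mul]
    exact Finset.card_nsmul_le_sum _ _ _ fun y hy ↦
      monomialWeight_anti hu hu1 (mem_generatedInBox.1 hy).1
  have h2 : (#(generatedInBox X B) : ℝ) ≤
      (monomialWeight u X)⁻¹ * ∏ a ∈ B, (1 - monomialWeight u a)⁻¹ := by
    rw [← div_eq_inv_mul, le_div_iff₀ hX]; exact h1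
  refine (Real.sqrt_le_sqrt h2).trans (le_of_eq ?_)
  rw [Real.sqrt_mul (inv_nonneg.2 hX.le), Real.sqrt_inv, Real.sqrt_prod]
  · simp_rw [Real.sqrt_inv]
  · intro a ha
    have : a ≠ 0 := by rintro rfl; exact hB ha
    exact inv_nonneg.2 (by linarith [monomialWeight_lt_one hu hu1 this])

/-- A telescoping comparison with the integral of 1/√(1 - x): consecutive values of √(1 - u^N) have
squares differing by u^N (1 - u). -/
theorem sum_range_pow_div_sqrt_le {u : ℝ} (h0 : 0 < u) (h1 : u < 1) (N : ℕ) :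
    ∑ a ∈ Finset.range (N + 1), (if a = 0 then 0 else u ^ a / √(1 - u ^ a)) ≤
      2 * (1 - u)⁻¹ * √(1 - u ^ N) := by
  have hu : 0 < 1 - u := by linarith
  induction N with
  | zero => simp
  | succ N ih =>
    rw [Finset.sum_range_succ, if_neg (Nat.succ_ne_zero N)]
    have hN1 : u ^ (N + 1) < 1 := pow_lt_one₀ h0.le h1 (Nat.succ_ne_zero N)
    have hN : u ^ N ≤ 1 := pow_le_one₀ h0.le h1.le
    have hpos : 0 < u ^ N := pow_pos h0 N
    have hmono : u ^ (N + 1) ≤ u ^ N := pow_le_pow_of_le_one h0.le h1.le (Nat.le_succ N)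
    set α := √(1 - u ^ (N + 1)) with hα
    set β := √(1 - u ^ N) with hβ
    have hα0 : 0 < α := Real.sqrt_pos.2 (by linarith)
    have hα2 : α ^ 2 = 1 - u ^ (N + 1) := Real.sq_sqrt (by linarith)
    have hβ2 : β ^ 2 = 1 - u ^ N := Real.sq_sqrt (by linarith)
    have hβα : β ≤ α := Real.sqrt_le_sqrt (by linarith)
    have hstep : u ^ (N + 1) / α ≤ 2 * (1 - u)⁻¹ * (α - β) := by
      have h2 : (1 - u) * u ^ (N + 1) ≤ (α - β) * (α + β) := by
        have : (α - β) * (α + β) = u ^ N * (1 - u) := by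
          calc (α - β) * (α + β) = α ^ 2 - β ^ 2 := by ring
            _ = u ^ N * (1 - u) := by rw [hα2, hβ2]; ring
        rw [this]; nlinarith
      have h3 : (1 - u) * u ^ (N + 1) ≤ (α - β) * (2 * α) := by nlinarith
      have h4 : u ^ (N + 1) ≤ (1 - u)⁻¹ * ((α - β) * (2 * α)) := by
        rw [← div_eq_inv_mul, le_div_iff₀ hu]; linarith
      rw [div_le_iff₀ hα0]
      linarith
    linarith

theorem inv_sqrt_one_sub_sub_one_le {w : ℝ} (h0 : 0 ≤ w) (h1 : w < 1) :
    (√(1 - w))⁻¹ - 1 ≤ w / √(1 - w) := by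
  have hs : 0 < √(1 - w) := Real.sqrt_pos.2 (by linarith)
  rw [le_div_iff₀ hs, sub_mul, inv_mul_cancel₀ hs.ne', one_mul]
  have : √(1 - w) ^ 2 = 1 - w := Real.sq_sqrt (by linarith)
  have : √(1 - w) ≤ 1 := Real.sqrt_le_one.2 (by linarith)
  nlinarith

theorem sum_inv_sqrt_one_sub_monomialWeight_le [DecidableEq ι] {u : ι → ℝ} (hu : ∀ l, 0 < u l)
    (hu1 : ∀ l, u l < 1) (N : ℕ) :
    ∑ a ∈ (Fintype.piFinset fun _ : ι ↦ Finset.range (N + 1)).erase 0,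
      ((√(1 - monomialWeight u a))⁻¹ - 1) ≤ 2 * Fintype.card ι * ∏ l, (1 - u l)⁻¹ := by
  -- If a i ≠ 0, replacing the full weight under the root by the larger u i ^ a i makes the summand
  -- a product over coordinates. Summing over i avoids choosing such an index.
  set h : ι → ι → ℕ → ℝ := fun i l a ↦
    if l = i then (if a = 0 then 0 else u l ^ a / √(1 - u l ^ a)) else u l ^ a with hh
  have hh0 (i l : ι) (a : ℕ) : 0 ≤ h i l a := by
    have := pow_pos (hu l) a
    simp only [hh]; split_ifs <;> positivity
  have hpt : ∀ a ∈ (Fintype.piFinset fun _ : ι ↦ Finset.range (N + 1)).erase 0,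
      (√(1 - monomialWeight u a))⁻¹ - 1 ≤ ∑ i, ∏ l, h i l (a l) := by
    intro a ha
    have ha0 : a ≠ 0 := (Finset.mem_erase.1 ha).1
    obtain ⟨i, hi⟩ := Function.ne_iff.1 ha0
    have hi : a i ≠ 0 := hi
    have hw0 := monomialWeight_pos hu a
    refine (inv_sqrt_one_sub_sub_one_le hw0.le (monomialWeight_lt_one hu hu1 ha0)).trans ?_
    have h1 : monomialWeight u a / √(1 - monomialWeight u a) ≤ ∏ l, h i l (a l) := by
      have h2 : ∏ l, h i l (a l) = monomialWeight u a / √(1 - u i ^ a i) := by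
        have h3 (l : ι) : h i l (a l) =
            u l ^ a l * (if l = i then (√(1 - u l ^ a l))⁻¹ else 1) := by
          simp only [hh]
          by_cases hl : l = i
          · subst hl; simp [hi, div_eq_mul_inv]
          · simp [hl]
        simp_rw [h3]
        rw [Finset.prod_mul_distrib, Finset.prod_ite_eq' Finset.univ i,
          if_pos (Finset.mem_univ i), div_eq_mul_inv]
        rfl
      rw [h2]
      have h4 : u i ^ a i < 1 := pow_lt_one₀ (hu i).le (hu1 i) hi
      have h5 : 0 < √(1 - u i ^ a i) := Real.sqrt_pos.2 (by linarith)
      gcongr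
      exact monomialWeight_le_pow hu hu1 a i
    exact h1.trans (Finset.single_le_sum (f := fun i ↦ ∏ l, h i l (a l))
      (fun i _ ↦ Finset.prod_nonneg fun l _ ↦ hh0 i l _) (Finset.mem_univ i))
  refine (Finset.sum_le_sum hpt).trans ?_
  refine (Finset.sum_le_sum_of_subset_of_nonneg (Finset.erase_subset _ _) fun a _ _ ↦
    Finset.sum_nonneg fun i _ ↦ Finset.prod_nonneg fun l _ ↦ hh0 i l _).trans ?_
  rw [Finset.sum_comm]
  have hi (i : ι) : ∑ a ∈ Fintype.piFinset fun _ : ι ↦ Finset.range (N + 1), ∏ l, h i l (a l) ≤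
      2 * ∏ l, (1 - u l)⁻¹ := by
    rw [← Finset.prod_univ_sum (fun _ : ι ↦ Finset.range (N + 1)) (h i)]
    calc ∏ l, ∑ a ∈ Finset.range (N + 1), h i l a
        ≤ ∏ l, ((if l = i then 2 else 1) * (1 - u l)⁻¹) := by
          refine Finset.prod_le_prod (fun l _ ↦ Finset.sum_nonneg fun a _ ↦ hh0 i l a) fun l _ ↦ ?_
          have hul : 0 < 1 - u l := by linarith [hu1 l]
          by_cases hl : l = i
          · simp only [hh, if_pos hl]
            refine (sum_range_pow_div_sqrt_le (hu l) (hu1 l) N).trans ?_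
            refine mul_le_of_le_one_right (by positivity) (Real.sqrt_le_one.2 ?_)
            linarith [pow_pos (hu l) N]
          · simp only [hh, if_neg hl, one_mul]
            rw [← tsum_geometric_of_lt_one (hu l).le (hu1 l)]
            exact (summable_geometric_of_lt_one (hu l).le (hu1 l)).sum_le_tsum _
              fun m _ ↦ pow_nonneg (hu l).le m
      _ = 2 * ∏ l, (1 - u l)⁻¹ := by
          rw [Finset.prod_mul_distrib, Finset.prod_ite_eq' Finset.univ i,
            if_pos (Finset.mem_univ i)]
  refine (Finset.sum_le_sum fun i _ ↦ hi i).trans (le_of_eq ?_)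
  rw [Finset.sum_const, Finset.card_univ, nsmul_eq_mul]
  ring

/-- Independence turns the mean of the product over generators into a product of means, and 1 + t ≤
e^t turns that into the exponential of a sum. The origin is excluded because its factor is singular.
-/
theorem bernoulliMean_sqrt_card_generatedInBox_le [DecidableEq ι] {p : ℝ} (h0 : 0 ≤ p)
    (h1 : p ≤ 1) {u : ι → ℝ} (hu : ∀ l, 0 < u l) (hu1 : ∀ l, u l < 1) (X : ι → ℕ) (N : ℕ) :
    bernoulliMean p ((Fintype.piFinset fun _ : ι ↦ Finset.range (N + 1)).erase 0)
      (fun B ↦ √(#(generatedInBox X B) : ℝ)) ≤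
      (√(monomialWeight u X))⁻¹ *
        Real.exp (p * (2 * Fintype.card ι * ∏ l, (1 - u l)⁻¹)) := by
  set W := (Fintype.piFinset fun _ : ι ↦ Finset.range (N + 1)).erase 0 with hW
  refine (bernoulliMean_mono h0 h1 fun B hB ↦ sqrt_card_generatedInBox_le hu hu1 X B
    fun hB0 ↦ Finset.notMem_erase 0 _ (hB hB0)).trans ?_
  rw [bernoulliMean_const_mul, bernoulliMean_prod]
  gcongr
  calc ∏ a ∈ W, (1 - p + p * (√(1 - monomialWeight u a))⁻¹)
      ≤ ∏ a ∈ W, Real.exp (p * ((√(1 - monomialWeight u a))⁻¹ - 1)) := by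
        refine Finset.prod_le_prod (fun a _ ↦ ?_) fun a _ ↦ ?_
        · have : 0 ≤ p * (√(1 - monomialWeight u a))⁻¹ := by positivity
          linarith
        · have := Real.add_one_le_exp (p * ((√(1 - monomialWeight u a))⁻¹ - 1))
          linarith
    _ = Real.exp (p * ∑ a ∈ W, ((√(1 - monomialWeight u a))⁻¹ - 1)) := by
        rw [← Real.exp_sum, Finset.mul_sum]
    _ ≤ _ := by
        gcongr
        exact sum_inv_sqrt_one_sub_monomialWeight_le hu hu1 N

end GeneratingFunction

/-! ### Sparsity below the threshold -/

section Sparse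

open Finset

/-- The largest lattice point `x` with `xₗ ≤ 2 ^ (jₗ + 1) * L` for all `l`. -/
noncomputable def dyadicCorner {d : ℕ} (L : ℝ) (j : Fin d → ℕ) (l : Fin d) : ℕ :=
  ⌊2 ^ (j l + 1) * L⌋₊

theorem half_le_one_sub_exp_neg {t : ℝ} (h0 : 0 ≤ t) (h1 : t ≤ 1) :
    t / 2 ≤ 1 - Real.exp (-t) := by
  have h : Real.exp (-t) ≤ (1 + t)⁻¹ := by
    rw [Real.exp_neg]
    gcongr
    linarith [Real.add_one_le_exp t]
  have h2 : (1 + t)⁻¹ ≤ 1 - t / 2 := by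
    rw [inv_le_iff_one_le_mul₀ (by linarith)]
    nlinarith
  linarith

theorem bernoulliMean_sqrt_card_dyadic_le {d : ℕ} (hd : 1 ≤ d) {p L Z : ℝ} (h0 : 0 ≤ p)
    (h1 : p ≤ 1) (hL : 1 ≤ L) (hZ : p * Z ≤ (((16 * d : ℝ)) ^ (d + 1))⁻¹ * L ^ (d + 1))
    (j : Fin d → ℕ) (hj : (∏ l, (2 : ℝ) ^ j l) * L ^ d ≤ Z) (N : ℕ) :
    bernoulliMean p ((Fintype.piFinset fun _ : Fin d ↦ Finset.range (N + 1)).erase 0)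
      (fun B ↦ √(#(generatedInBox (dyadicCorner L j) B) : ℝ)) ≤ Real.exp (L / 4) := by
  have hD : (1 : ℝ) ≤ d := by exact_mod_cast hd
  have hL0 : 0 < L := by linarith
  -- Balances the two factors: the weight of the corner is at least e^(-L/4), giving e^(L/8) after
  -- the square root, and `hZ` makes the exponent from the generators at most L/8.
  set t : Fin d → ℝ := fun l ↦ 1 / (4 * d * 2 ^ (j l + 1)) with ht
  have ht0 (l : Fin d) : 0 < t l := by simp only [ht]; positivity
  have ht1 (l : Fin d) : t l ≤ 1 := by
    simp only [ht]
    rw [div_le_one (by positivity)]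
    have : (1 : ℝ) ≤ 2 ^ (j l + 1) := one_le_pow₀ (by norm_num)
    nlinarith
  set u : Fin d → ℝ := fun l ↦ Real.exp (-t l) with hu
  have hu0 (l : Fin d) : 0 < u l := Real.exp_pos _
  have hu1 (l : Fin d) : u l < 1 := by
    rw [← Real.exp_zero]; exact Real.exp_lt_exp.2 (by linarith [ht0 l])
  refine (bernoulliMean_sqrt_card_generatedInBox_le h0 h1 hu0 hu1 (dyadicCorner L j) N).trans ?_
  have hw : Real.exp (-(L / 4)) ≤ monomialWeight u (dyadicCorner L j) := by
    have e1 : monomialWeight u (dyadicCorner L j) =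
        Real.exp (∑ l, (dyadicCorner L j l : ℝ) * (-t l)) := by
      rw [Real.exp_sum]
      exact Finset.prod_congr rfl fun l _ ↦ (Real.exp_nat_mul _ _).symm
    rw [e1]
    refine Real.exp_le_exp.2 ?_
    have e2 (l : Fin d) : -(L / (4 * d)) ≤ (dyadicCorner L j l : ℝ) * (-t l) := by
      have e3 : (dyadicCorner L j l : ℝ) ≤ 2 ^ (j l + 1) * L := Nat.floor_le (by positivity)
      have e4 : (dyadicCorner L j l : ℝ) * t l ≤ 2 ^ (j l + 1) * L * t l :=
        mul_le_mul_of_nonneg_right e3 (ht0 l).le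
      have e5 : 2 ^ (j l + 1) * L * t l = L / (4 * d) := by
        simp only [ht]; field_simp
      linarith
    calc -(L / 4) = ∑ l : Fin d, -(L / (4 * d)) := by
          rw [Finset.sum_const, Finset.card_univ, Fintype.card_fin, nsmul_eq_mul]; field_simp
      _ ≤ _ := Finset.sum_le_sum fun l _ ↦ e2 l
  have hsqrt : (√(monomialWeight u (dyadicCorner L j)))⁻¹ ≤ Real.exp (L / 8) := by
    rw [inv_le_comm₀ (Real.sqrt_pos.2 (monomialWeight_pos hu0 _)) (Real.exp_pos _), ← Real.exp_neg]
    refine Real.le_sqrt_of_sq_le (le_trans (le_of_eq ?_) hw)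
    rw [← Real.exp_nat_mul]; congr 1; push_cast; ring
  have hexp : p * (2 * Fintype.card (Fin d) * ∏ l, (1 - u l)⁻¹) ≤ L / 8 := by
    have e1 : ∏ l, (1 - u l)⁻¹ ≤ ∏ l, (16 * d * 2 ^ j l : ℝ) := by
      refine Finset.prod_le_prod (fun l _ ↦ inv_nonneg.2 (by linarith [hu1 l])) fun l _ ↦ ?_
      have e2 := half_le_one_sub_exp_neg (ht0 l).le (ht1 l)
      rw [inv_le_comm₀ (by linarith [hu1 l]) (by positivity)]
      refine le_trans (le_of_eq ?_) e2
      simp only [ht]; rw [pow_succ]; field_simp; norm_num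
    rw [Finset.prod_mul_distrib, Finset.prod_const, Finset.card_univ, Fintype.card_fin] at e1
    have hZ' : p * ((∏ l, (2 : ℝ) ^ j l) * L ^ d) ≤ ((16 * d : ℝ) ^ (d + 1))⁻¹ * L ^ (d + 1) :=
      (mul_le_mul_of_nonneg_left hj h0).trans hZ
    have e3 : p * ∏ l, (2 : ℝ) ^ j l ≤ ((16 * d : ℝ) ^ (d + 1))⁻¹ * L := by
      have hLd : 0 < L ^ d := by positivity
      refine le_of_mul_le_mul_right ?_ hLd
      calc p * (∏ l, (2 : ℝ) ^ j l) * L ^ d = p * ((∏ l, (2 : ℝ) ^ j l) * L ^ d) := by ring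
        _ ≤ _ := hZ'
        _ = _ := by ring
    rw [Fintype.card_fin]
    calc p * (2 * d * ∏ l, (1 - u l)⁻¹)
        ≤ p * (2 * d * ((16 * d) ^ d * ∏ l, (2 : ℝ) ^ j l)) := by gcongr
      _ = 2 * d * (16 * d) ^ d * (p * ∏ l, (2 : ℝ) ^ j l) := by ring
      _ ≤ 2 * d * (16 * d) ^ d * (((16 * d : ℝ) ^ (d + 1))⁻¹ * L) := by gcongr
      _ = L / 8 := by rw [pow_succ]; field_simp; norm_num
  calc _ ≤ Real.exp (L / 8) * Real.exp (L / 8) :=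
        mul_le_mul hsqrt (Real.exp_le_exp.2 hexp) (Real.exp_pos _).le (Real.exp_pos _).le
    _ = Real.exp (L / 4) := by rw [← Real.exp_add]; ring_nf

open scoped Classical in
/-- Indices of the dyadic boxes needed to cover the region `∏ (xₗ + L) ≤ Z`. -/
noncomputable def dyadicIndices (d : ℕ) (L Z : ℝ) : Finset (Fin d → ℕ) :=
  (Fintype.piFinset fun _ : Fin d ↦ Finset.range (⌊4 * L⌋₊ + 1)).filter
    fun j ↦ (∏ l, (2 : ℝ) ^ j l) * L ^ d ≤ Z

theorem card_dyadicIndices_le (d : ℕ) {L : ℝ} (hL : 1 ≤ L) (Z : ℝ) :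
    (#(dyadicIndices d L Z) : ℝ) ≤ (5 * L) ^ d := by
  have h : #(dyadicIndices d L Z) ≤ (⌊4 * L⌋₊ + 1) ^ d := by
    refine (Finset.card_filter_le _ _).trans ?_
    simp
  calc (#(dyadicIndices d L Z) : ℝ) ≤ ((⌊4 * L⌋₊ : ℝ) + 1) ^ d := by exact_mod_cast h
    _ ≤ (5 * L) ^ d := by
      gcongr
      linarith [Nat.floor_le (by positivity : 0 ≤ 4 * L)]

theorem exists_mem_dyadicIndices {d : ℕ} {L Z : ℝ} (hL : 1 ≤ L) (hZ : Z ≤ Real.exp (2 * L))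
    {x : Fin d → ℕ} (hx : ∏ l, ((x l : ℝ) + L) ≤ Z) :
    ∃ j ∈ dyadicIndices d L Z, x ≤ dyadicCorner L j := by
  have hL0 : 0 < L := by linarith
  have hnear (l : Fin d) : ∃ n : ℕ, 2 ^ n ≤ ((x l : ℝ) + L) / L ∧
      ((x l : ℝ) + L) / L < 2 ^ (n + 1) := by
    refine exists_nat_pow_near ?_ (by norm_num)
    rw [le_div_iff₀ hL0]
    linarith [Nat.cast_nonneg (α := ℝ) (x l)]
  choose j hj1 hj2 using hnear
  refine ⟨j, Finset.mem_filter.2 ⟨Fintype.mem_piFinset.2 fun l ↦ ?_, ?_⟩, fun l ↦ ?_⟩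
  · rw [Finset.mem_range, Nat.lt_succ_iff]
    refine Nat.le_floor ?_
    have h1 : (2 : ℝ) ^ j l ≤ Real.exp (2 * L) := by
      have h2 := le_prod_add hL x l
      have h3 : ((x l : ℝ) + L) / L ≤ (x l : ℝ) + L := div_le_self (by positivity) hL
      linarith [hj1 l]
    -- Since √e ≤ 2, the bound 2^j ≤ e^(2L) gives j ≤ 4L, the range allowed in `dyadicIndices`.
    have h4 : Real.exp (1 / 2 * j l) ≤ 2 ^ j l := by
      rw [mul_comm, Real.exp_nat_mul]
      refine pow_le_pow_left₀ (Real.exp_pos _).le ?_ _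
      have h5 : Real.exp (1 / 2) ^ 2 = Real.exp 1 := by
        rw [← Real.exp_nat_mul]; norm_num
      nlinarith [Real.exp_one_lt_d9, Real.exp_pos (1 / 2)]
    have h6 := Real.exp_le_exp.1 (h4.trans h1)
    linarith
  · refine le_trans ?_ hx
    calc (∏ l, (2 : ℝ) ^ j l) * L ^ d = ∏ l, ((2 : ℝ) ^ j l * L) := by
          rw [Finset.prod_mul_distrib]; simp
      _ ≤ _ := by
          refine Finset.prod_le_prod (fun l _ ↦ by positivity) fun l _ ↦ ?_
          exact (le_div_iff₀ hL0).1 (hj1 l)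
  · refine Nat.le_floor ?_
    have := (div_lt_iff₀ hL0).1 (hj2 l)
    linarith

/-- All summands of y lie below y, so whether y is generated depends only on a finite window. -/
theorem mem_closure_le_of_mem_closure {ι : Type*} {A : Set (ι → ℕ)} {y : ι → ℕ}
    (hy : y ∈ AddSubmonoid.closure A) : y ∈ AddSubmonoid.closure {a ∈ A | a ≤ y ∧ a ≠ 0} := by
  induction hy using AddSubmonoid.closure_induction with
  | mem a ha =>
    by_cases h : a = 0
    · rw [h]; exact zero_mem _
    · exact AddSubmonoid.subset_closure ⟨ha, le_rfl, h⟩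
  | zero => exact zero_mem _
  | add x y _ _ hx hy =>
    refine add_mem (AddSubmonoid.closure_mono ?_ hx) (AddSubmonoid.closure_mono ?_ hy)
    · exact fun a ha ↦ ⟨ha.1, ha.2.1.trans (le_add_of_nonneg_right zero_le), ha.2.2⟩
    · exact fun a ha ↦ ⟨ha.1, ha.2.1.trans (le_add_of_nonneg_left zero_le), ha.2.2⟩

/-- With probability close to `1` the semigroup meets at most `θ` points of the region. -/
theorem setBernoulli_lt_ncard_inter_region_le {d : ℕ} (hd : 1 ≤ d) (p : I) {L Z : ℝ}
    (hpL : L = Real.log (p : ℝ)⁻¹) (hL : 1 ≤ L)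
    (hZ : (p : ℝ) * Z ≤ ((16 * d : ℝ) ^ (d + 1))⁻¹ * L ^ (d + 1)) (hZL : Z ≤ Real.exp (2 * L))
    {θ : ℝ} (hθ : 0 < θ) :
    setBernoulli (Set.univ : Set (Fin d → ℕ)) p
      {A | θ < ((generatedSemigroup A ∩ hyperboloidRegion d (p : ℝ) Z).ncard : ℝ)} ≤
      ENNReal.ofReal ((5 * L) ^ d * Real.exp (L / 4) / √θ) := by
  have h0 : (0 : ℝ) ≤ p := p.2.1
  have h1 : (p : ℝ) ≤ 1 := p.2.2
  set W := (Fintype.piFinset fun _ : Fin d ↦ Finset.range (⌊Z⌋₊ + 1)).erase 0 with hW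
  set J := dyadicIndices d L Z with hJ
  refine (setBernoulli_le_bernoulliMean p W _
    {B | θ < ∑ j ∈ J, (#(generatedInBox (dyadicCorner L j) B) : ℝ)}
    fun A hA B hB hAB ↦ ?_).trans (ENNReal.ofReal_le_ofReal ?_)
  · change θ < _ at hA
    change θ < _
    refine lt_of_lt_of_le hA ?_
    have hsub : generatedSemigroup A ∩ hyperboloidRegion d (p : ℝ) Z ⊆
        ((J.biUnion fun j ↦ generatedInBox (dyadicCorner L j) B : Finset (Fin d → ℕ)) :
          Set (Fin d → ℕ)) := by
      rintro y ⟨hyA, hyR⟩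
      have hyR' : ∏ l, ((y l : ℝ) + L) ≤ Z := by rw [hpL]; exact hyR
      obtain ⟨j, hj, hyj⟩ := exists_mem_dyadicIndices hL hZL hyR'
      refine Finset.mem_coe.2 (Finset.mem_biUnion.2 ⟨j, hj, mem_generatedInBox.2 ⟨hyj, ?_⟩⟩)
      refine AddSubmonoid.closure_mono ?_ (mem_closure_le_of_mem_closure hyA)
      rintro a ⟨haA, hay, ha0⟩
      refine (hAB a (Finset.mem_erase.2 ⟨ha0, Fintype.mem_piFinset.2 fun l ↦ ?_⟩)).1 haA
      have hmem := (Finset.mem_filter.1 ((mem_regionFinset hL).2 hyR')).1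
      have h2 := Finset.mem_range.1 (Fintype.mem_piFinset.1 hmem l)
      have h3 : a l ≤ y l := hay l
      exact Finset.mem_range.2 (by omega)
    have hcard := Set.ncard_le_ncard hsub (Finset.finite_toSet _)
    rw [Set.ncard_coe_finset] at hcard
    exact_mod_cast hcard.trans Finset.card_biUnion_le
  · have hsθ : 0 < √θ := Real.sqrt_pos.2 hθ
    -- Markov's inequality for the square root of the total count, split over the boxes by
    -- subadditivity of the square root.
    have hpt (B : Finset (Fin d → ℕ)) :
        ({B | θ < ∑ j ∈ J, (#(generatedInBox (dyadicCorner L j) B) : ℝ)} :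
          Set (Finset (Fin d → ℕ))).indicator 1 B ≤
        (√θ)⁻¹ * ∑ j ∈ J, √(#(generatedInBox (dyadicCorner L j) B) : ℝ) := by
      by_cases hB : θ < ∑ j ∈ J, (#(generatedInBox (dyadicCorner L j) B) : ℝ)
      · rw [Set.indicator_of_mem (by exact hB), Pi.one_apply, ← div_eq_inv_mul, le_div_iff₀ hsθ,
          one_mul]
        exact (Real.sqrt_le_sqrt hB.le).trans (sqrt_sum_le_sum_sqrt J fun j ↦ Nat.cast_nonneg _)
      · rw [Set.indicator_of_notMem (by exact hB)]
        exact mul_nonneg (inv_nonneg.2 hsθ.le) (Finset.sum_nonneg fun j _ ↦ Real.sqrt_nonneg _)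
    refine (bernoulliMean_mono h0 h1 fun B _ ↦ hpt B).trans ?_
    rw [bernoulliMean_const_mul, bernoulliMean_sum, div_eq_inv_mul]
    refine mul_le_mul_of_nonneg_left ?_ (inv_nonneg.2 hsθ.le)
    refine (Finset.sum_le_card_nsmul J _ (Real.exp (L / 4)) fun j hj ↦
      bernoulliMean_sqrt_card_dyadic_le hd h0 h1 hL hZ j (Finset.mem_filter.1 hj).2 ⌊Z⌋₊).trans ?_
    rw [nsmul_eq_mul]
    gcongr
    exact card_dyadicIndices_le d hL Z

/-- The density bound for the semigroup below the threshold, `p ^ (1 / 4)`. -/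
noncomputable def sparsityBound (p : I) : ℝ := Real.exp (-(Real.log (p : ℝ)⁻¹ / 4))

theorem tendsto_sparsityBound : Tendsto sparsityBound (𝓝[>] (0 : I)) (𝓝 0) :=
  Real.tendsto_exp_neg_atTop_nhds_zero.comp
    (tendsto_log_inv_unitInterval.atTop_div_const (by norm_num))

theorem tendsto_setBernoulli_not_sparse {d : ℕ} (hd : 1 ≤ d) {κ : ℝ} (hκ0 : 0 < κ)
    (hκ : κ ≤ ((16 * d : ℝ) ^ (d + 1))⁻¹) :
    Tendsto (fun p : I ↦ setBernoulli (Set.univ : Set (Fin d → ℕ)) p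
      {A | ¬ ((generatedSemigroup A ∩
          hyperboloidRegion d (p : ℝ) (κ * thresholdScale d (p : ℝ))).ncard : ℝ) ≤
        sparsityBound p * ((hyperboloidRegion d (p : ℝ) (κ * thresholdScale d (p : ℝ))).ncard : ℝ)})
      (𝓝[>] (0 : I)) (𝓝 0) := by
  obtain ⟨a, _, ha, _, hev⟩ := exists_card_regionFinset_bounds d hd hκ0
  have hlim : Tendsto (fun p : I ↦ ENNReal.ofReal (Real.exp (-(Real.log (p : ℝ)⁻¹ / 16))))
      (𝓝[>] (0 : I)) (𝓝 0) := by
    have h1 : Tendsto (fun p : I ↦ Real.exp (-(Real.log (p : ℝ)⁻¹ / 16))) (𝓝[>] (0 : I)) (𝓝 0) :=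
      Real.tendsto_exp_neg_atTop_nhds_zero.comp
        (tendsto_log_inv_unitInterval.atTop_div_const (by norm_num))
    have h2 := ENNReal.tendsto_ofReal h1
    rwa [ENNReal.ofReal_zero] at h2
  refine tendsto_of_tendsto_of_tendsto_of_le_of_le' tendsto_const_nhds hlim
    (Eventually.of_forall fun _ ↦ zero_le) ?_
  filter_upwards [self_mem_nhdsWithin, tendsto_log_inv_unitInterval.eventually_ge_atTop 1,
    tendsto_log_inv_unitInterval.eventually hev,
    tendsto_log_inv_unitInterval.eventually
      (eventually_const_mul_pow_le_exp κ (d + 1) one_pos),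
    tendsto_log_inv_unitInterval.eventually
      (eventually_const_mul_pow_le_exp (5 ^ d / √a) d (by norm_num : (0 : ℝ) < 1 / 16))]
    with p hp hL1 hcount hexp hexp2
  have h0 : (0 : ℝ) < p := by exact_mod_cast hp
  have hset := coe_regionFinset (d := d) (Z := κ * thresholdScale d (p : ℝ)) hL1
  unfold sparsityBound
  have hpinv : Real.exp (Real.log (p : ℝ)⁻¹) = (p : ℝ)⁻¹ := Real.exp_log (by positivity)
  have hT : thresholdScale d (p : ℝ) =
      Real.exp (Real.log (p : ℝ)⁻¹) * Real.log (p : ℝ)⁻¹ ^ (d + 1) := by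
    rw [hpinv]; rfl
  set Z := κ * thresholdScale d (p : ℝ) with hZ
  rw [← hT, ← hZ] at hcount
  rw [← hset, Set.ncard_coe_finset]
  rw [hset]
  obtain ⟨L, hL⟩ : ∃ L, L = Real.log (p : ℝ)⁻¹ := ⟨_, rfl⟩
  rw [← hL] at hL1 hcount hexp hexp2 hpinv hT ⊢
  have hcard : a * Real.exp L ≤ #(regionFinset d L Z) := by
    refine le_trans ?_ hcount.1
    have : 1 ≤ L ^ (2 * d) := one_le_pow₀ hL1
    have h2 := Real.exp_pos L
    rw [← mul_assoc]
    exact le_mul_of_one_le_right (by positivity) this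
  -- The root of this Markov threshold has order at least e^(3L/8), against a mean of at most (5L)^d
  -- e^(L/4); the ratio is at most e^(-L/16) eventually.
  have hθ : a * Real.exp (3 * L / 4) ≤ Real.exp (-(L / 4)) * #(regionFinset d L Z) := by
    calc a * Real.exp (3 * L / 4) = Real.exp (-(L / 4)) * (a * Real.exp L) := by
          rw [mul_left_comm, ← Real.exp_add]; ring_nf
      _ ≤ _ := by gcongr
  have hθ0 : 0 < a * Real.exp (3 * L / 4) := by positivity
  simp only [not_le]
  refine (setBernoulli_lt_ncard_inter_region_le hd p hL hL1 ?_ ?_ (hθ0.trans_le hθ)).trans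
    (ENNReal.ofReal_le_ofReal ?_)
  · rw [hZ, hT, hpinv]
    calc (p : ℝ) * (κ * ((p : ℝ)⁻¹ * L ^ (d + 1))) = κ * L ^ (d + 1) := by field_simp
      _ ≤ _ := by gcongr
  · rw [hZ, hT]
    rw [one_mul] at hexp
    calc κ * (Real.exp L * L ^ (d + 1)) = Real.exp L * (κ * L ^ (d + 1)) := by ring
      _ ≤ Real.exp L * Real.exp L := by gcongr
      _ = Real.exp (2 * L) := by rw [← Real.exp_add]; ring_nf
  · have hs : √a * Real.exp (3 * L / 8) ≤ √(Real.exp (-(L / 4)) * #(regionFinset d L Z)) := by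
      refine le_trans (le_of_eq ?_) (Real.sqrt_le_sqrt hθ)
      rw [Real.sqrt_mul ha.le]
      congr 1
      rw [eq_comm, Real.sqrt_eq_iff_mul_self_eq (Real.exp_pos _).le (Real.exp_pos _).le,
        ← Real.exp_add]
      ring_nf
    have hsa : 0 < √a := Real.sqrt_pos.2 ha
    calc (5 * L) ^ d * Real.exp (L / 4) / √(Real.exp (-(L / 4)) * #(regionFinset d L Z))
        ≤ (5 * L) ^ d * Real.exp (L / 4) / (√a * Real.exp (3 * L / 8)) := by gcongr
      _ = (5 ^ d / √a * L ^ d) * (Real.exp (L / 4) / Real.exp (3 * L / 8)) := by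
          rw [mul_pow]; field_simp
      _ ≤ Real.exp (1 / 16 * L) * (Real.exp (L / 4) / Real.exp (3 * L / 8)) := by gcongr
      _ = Real.exp (-(L / 16)) := by
          rw [← Real.exp_sub, ← Real.exp_add]; ring_nf

end Sparse

/-! ### The main theorem -/

theorem theorem1p2 (d : ℕ) (hd : 1 ≤ d) :
    ∃ C : ℝ, 0 < C ∧
    ∃ c₁ : ℝ, 0 < c₁ ∧ ∃ c₂ : ℝ, 0 < c₂ ∧
    ∃ ε : I → ℝ, Tendsto ε (𝓝[>] (0 : I)) (𝓝 0) ∧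
      WithHighProbability d (fun p A ↦
        ((generatedSemigroup A ∩
              hyperboloidRegion d (p : ℝ) (C⁻¹ * thresholdScale d (p : ℝ))).ncard : ℝ)
            ≤ ε p *
              ((hyperboloidRegion d (p : ℝ) (C⁻¹ * thresholdScale d (p : ℝ))).ncard : ℝ) ∧
        (hyperboloidRegion d (p : ℝ) (C * thresholdScale d (p : ℝ)))ᶜ ⊆ generatedSemigroup A ∧
        (generatedSemigroup A)ᶜ.Finite ∧
        c₁ * ((p : ℝ)⁻¹ * Real.log (p : ℝ)⁻¹ ^ (2 * d)) ≤ ((generatedSemigroup A)ᶜ.ncard : ℝ) ∧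
        ((generatedSemigroup A)ᶜ.ncard : ℝ) ≤
          c₂ * ((p : ℝ)⁻¹ * Real.log (p : ℝ)⁻¹ ^ (2 * d))) := by
  obtain ⟨C₀, hC₀, hcover⟩ := exists_tendsto_setBernoulli_not_compl_subset d hd
  -- The first term serves the covering statement; the second makes C⁻¹ small enough for sparsity.
  set C := max C₀ ((16 * d : ℝ) ^ (d + 1)) with hC
  have hC0 : 0 < C := lt_of_lt_of_le (by linarith) (le_max_left _ _)
  have hd0 : (0 : ℝ) < d := by exact_mod_cast hd
  have hCinv : C⁻¹ ≤ ((16 * d : ℝ) ^ (d + 1))⁻¹ := by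
    gcongr
    exact le_max_right _ _
  obtain ⟨a, _, ha, _, hlow⟩ := exists_card_regionFinset_bounds d hd (inv_pos.2 hC0)
  obtain ⟨_, b, _, hb, hup⟩ := exists_card_regionFinset_bounds d hd hC0
  have hbad := (tendsto_setBernoulli_not_sparse hd (inv_pos.2 hC0) hCinv).add
    (hcover C (le_max_left _ _))
  refine ⟨C, hC0, a / 2, by positivity, b, hb, sparsityBound, tendsto_sparsityBound, ?_⟩
  have hlim := ENNReal.Tendsto.sub (tendsto_const_nhds (x := (1 : ENNReal))) hbad
    (Or.inl ENNReal.one_ne_top)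
  rw [add_zero, tsub_zero] at hlim
  refine tendsto_of_tendsto_of_tendsto_of_le_of_le' hlim tendsto_const_nhds ?_
    (Eventually.of_forall fun _ ↦ MeasureTheory.prob_le_one)
  filter_upwards [self_mem_nhdsWithin, tendsto_log_inv_unitInterval.eventually_ge_atTop 1,
    tendsto_log_inv_unitInterval.eventually hlow, tendsto_log_inv_unitInterval.eventually hup,
    tendsto_sparsityBound.eventually_le_const (by norm_num : (0 : ℝ) < 1 / 2)]
    with p hp hL1 hlow hup hε
  have h0 : (0 : ℝ) < p := by exact_mod_cast hp
  have hpinv : Real.exp (Real.log (p : ℝ)⁻¹) = (p : ℝ)⁻¹ := Real.exp_log (by positivity)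
  rw [hpinv] at hlow hup
  have hset (Z : ℝ) := coe_regionFinset (d := d) (Z := Z) hL1
  -- The good event and the two bad events cover the whole space, so subadditivity bounds the good
  -- one from below without measurability.
  rw [tsub_le_iff_right, ← MeasureTheory.measure_univ
    (μ := setBernoulli (Set.univ : Set (Fin d → ℕ)) p)]
  refine le_trans (MeasureTheory.measure_mono ?_) ((MeasureTheory.measure_union_le _ _).trans
    (add_le_add_right (MeasureTheory.measure_union_le _ _) _))
  intro A _
  by_contra hA
  simp only [Set.mem_union, Set.mem_ofPred_eq, not_or, not_not] at hA
  obtain ⟨hgood, hsparse, hcov⟩ := hA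
  have hsub : (generatedSemigroup A)ᶜ ⊆
      (regionFinset d (Real.log (p : ℝ)⁻¹) (C * thresholdScale d (p : ℝ)) : Set (Fin d → ℕ)) := by
    rw [hset]; exact Set.compl_subset_comm.1 hcov
  have hfin : (generatedSemigroup A)ᶜ.Finite := (Finset.finite_toSet _).subset hsub
  refine hgood ⟨hsparse, hcov, hfin, ?_, ?_⟩
  · have h1 : (hyperboloidRegion d (p : ℝ) (C⁻¹ * thresholdScale d (p : ℝ))).ncard ≤
        (generatedSemigroup A)ᶜ.ncard + (generatedSemigroup A ∩
          hyperboloidRegion d (p : ℝ) (C⁻¹ * thresholdScale d (p : ℝ))).ncard := by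
      have hRfin : (hyperboloidRegion d (p : ℝ) (C⁻¹ * thresholdScale d (p : ℝ))).Finite := by
        rw [← hset]; exact Finset.finite_toSet _
      refine (Set.ncard_le_ncard ?_ (hfin.union (hRfin.subset Set.inter_subset_right))).trans
        (Set.ncard_union_le _ _)
      intro x hx
      by_cases hxA : x ∈ generatedSemigroup A
      · exact Or.inr ⟨hxA, hx⟩
      · exact Or.inl hxA
    have h2 : ((hyperboloidRegion d (p : ℝ) (C⁻¹ * thresholdScale d (p : ℝ))).ncard : ℝ) ≤
        (generatedSemigroup A)ᶜ.ncard + (generatedSemigroup A ∩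
          hyperboloidRegion d (p : ℝ) (C⁻¹ * thresholdScale d (p : ℝ))).ncard := by
      exact_mod_cast h1
    have h3 : a * ((p : ℝ)⁻¹ * Real.log (p : ℝ)⁻¹ ^ (2 * d)) ≤
        ((hyperboloidRegion d (p : ℝ) (C⁻¹ * thresholdScale d (p : ℝ))).ncard : ℝ) := by
      rw [← hset, Set.ncard_coe_finset]
      exact hlow.1
    -- As `sparsityBound p` ≤ 1/2, at least half of the lower region consists of gaps, hence the
    -- constant a / 2.
    nlinarith [Nat.cast_nonneg (α := ℝ)
      (hyperboloidRegion d (p : ℝ) (C⁻¹ * thresholdScale d (p : ℝ))).ncard]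
  · refine le_trans ?_ hup.2
    have := Set.ncard_le_ncard hsub (Finset.finite_toSet _)
    rw [Set.ncard_coe_finset] at this
    exact_mod_cast this
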